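/- Let $A$ be a finite-dimensional Hopf algebra over a field $k$ with invertible antipode $S$. Let $A^\circ$ be the dual Hopf algebra with opposite comultiplication (so $\langle\lambda\rho,y\rangle=\langle\lambda\otimes\rho,\Delta y\rangle$, $\langle\Delta\lambda,y\otimes z\rangle=\lambda(zy)$, and the antipode of $A^\circ$ is the transpose of $S^{-1}$). Let $D(A)$ be the quantum double: the Hopf algebra $A^\circ\otimes A$ containing $A^\circ$ and $A$ as Hopf subalgebras, in which $\lambda\otimes y$ is the product $\lambda\cdot y$ and $$y\cdot\lambda=\sum\langle\lambda_{(1)},y_{(1)}\rangle\,\langle S(\lambda_{(3)}),y_{(3)}\rangle\,\lambda_{(2)}\cdot y_{(2)}=\sum\lambda\bigl(S^{-1}(y_{(3)})\,-\,y_{(1)}\bigr)\cdot y_{(2)}.$$ For dual bases $(e_i)$ of $A$ and $(f_i)$ of $A^\circ$ put $R=\sum_i e_i\otimes f_i$, $M=\tau(R)R=\sum_{i,j}f_je_i\otimes e_jf_i$ (with $\tau$ the flip), and $u=\sum_i S(f_i)e_i$. Let $\mu\in A^*$ and $x\in A$ satisfy $(\mathrm{id}\otimes\mu)\Delta(h)=\mu(h)1$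 and $hx=\epsilon(h)x$ for all $h\in A$, and $\mu(x)=1$. Let $\alpha\in A^*$ and $a\in A$ be the modulus and comodulus, defined by $xh=\alpha(h)x$ and $(\mu\otimes\mathrm{id})\Delta(h)=\mu(h)a$ for all $h\in A$, and put $\omega=\alpha(a)$. Let $\mu_D$ be the linear form on $D(A)$ with $\mu_D(\lambda\cdot y)=\lambda(x)\,\mu(S(y))$, let $\chi$ be the linear form with $\chi(\lambda\cdot y)=\lambda(y)$, and let $$\mathcal S:D(A)\to D(A),\qquad \mathcal S(y)=\sum_{i,j}\mu_D(y f_je_i)\,S(f_i)S(e_j).$$ Let $v\in D(A)$ be a ribbon element, that is, $v$ is invertible and central, $S(v)=v$, and $M=(v\otimes v)\Delta(v^{-1})$. Let $b=v^{-1}u$ be the associated balancing and let $\nu\in k$ be defined by $\nu^{-1}=\chi(b)$. Then $\nu$ is a well-defined nonzero element of $k$ with $\nu^4=\omega$, and $$\mathcal S(v)=\nu^{-1}v^{-1},\qquad \mathcal S(v^{-1})=\nu^5\,v .$$ -/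

import Mathlib

open scoped TensorProduct

noncomputable section

namespace QDouble

open Module (Dual)
open HopfAlgebra (antipode)

variable (k : Type*) [Field k] (A : Type*) [Ring A] [HopfAlgebra k A]

/-- The inverse `S⁻¹` of the antipode of `A`, as a linear endomorphism
(the inverse in the monoid `Module.End k A`; meaningful when `S` is bijective). -/
def antipodeInv : A →ₗ[k] A :=
  Ring.inverse (M₀ := Module.End k A) (antipode k : A →ₗ[k] A)

/-! ### Integrals of `A` -/

variable {k A}

/-- `μ` is a left integral: `(id ⊗ μ) Δ(h) = μ(h) 1`. -/
def IsLeftIntegral (μ : Dual k A) : Prop :=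
  ∀ h : A, TensorProduct.rid k A (μ.lTensor A (Coalgebra.comul h)) = μ h • (1 : A)

/-- `x` is a left cointegral: `h x = ε(h) x`. -/
def IsLeftCointegral (k : Type*) [Field k] {A : Type*} [Ring A] [HopfAlgebra k A] (x : A) : Prop :=
  ∀ h : A, h * x = (Coalgebra.counit h : k) • x

/-- `α` is the modulus of the left cointegral `x`: `x h = α(h) x`. -/
def IsModulus (x : A) (α : Dual k A) : Prop :=
  ∀ h : A, x * h = α h • x

/-- `a` is the comodulus of the left integral `μ`: `(μ ⊗ id) Δ(h) = μ(h) a`. -/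
def IsComodulus (μ : Dual k A) (a : A) : Prop :=
  ∀ h : A, TensorProduct.lid k A (μ.rTensor A (Coalgebra.comul h)) = μ h • a

/-! ### The Hopf algebra `A°`: the dual of `A` with opposite comultiplication -/

variable (k A)

/-- The product of `A°`: `(λ ρ)(y) = (λ ⊗ ρ)(Δ y)`. -/
def dualMul : Dual k A ⊗[k] Dual k A →ₗ[k] Dual k A :=
  (Coalgebra.comul : A →ₗ[k] A ⊗[k] A).dualMap ∘ₗ TensorProduct.dualDistrib k A A

/-- The unit of `A°`. -/
def dualOne : Dual k A := Coalgebra.counit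

/-- The coproduct of `A°`: `⟨Δ λ, y ⊗ z⟩ = λ(z y)`. -/
def dualComul [FiniteDimensional k A] : Dual k A →ₗ[k] Dual k A ⊗[k] Dual k A :=
  (TensorProduct.dualDistribEquiv k A A).symm.toLinearMap ∘ₗ
    (LinearMap.mul' k A ∘ₗ (TensorProduct.comm k A A).toLinearMap).dualMap

/-- The antipode of `A°`: the transpose of `S⁻¹`. -/
def dualAntipode : Dual k A →ₗ[k] Dual k A := (antipodeInv k A).dualMap

/-! ### The double `D(A)`

The underlying space is `A° ⊗ A`, the pure tensor `l ⊗ₜ y` standing for the product `l · y`.  The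
product is determined by the products of `A°` and `A` and by the bicrossing map
`y · l = ∑ l(S⁻¹(y₍₃₎) - y₍₁₎) · y₍₂₎`, that is,
`y · l = ∑ ⟨l₍₁₎, y₍₁₎⟩ ⟨S l₍₃₎, y₍₃₎⟩ l₍₂₎ · y₍₂₎` in terms of the coproduct and antipode of `A°`. -/

/-- The underlying vector space of the double `D(A)`.  The product on it is `Double.mul` below. -/
abbrev Double : Type _ := Dual k A ⊗[k] A

variable {k A}

/-- `sandwich l p r` is the functional `t ↦ l (S⁻¹(r) t p)`. -/
def sandwich (l : Dual k A) : A →ₗ[k] A →ₗ[k] Dual k A :=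
  LinearMap.mk₂ k
    (fun p r => l ∘ₗ LinearMap.mulLeft k (antipodeInv k A r) ∘ₗ LinearMap.mulRight k p)
    (fun _ _ _ => by ext; simp [mul_add])
    (fun _ _ _ => by ext; simp)
    (fun _ _ _ => by ext; simp [add_mul])
    (fun _ _ _ => by ext; simp)

@[simp] lemma sandwich_apply (l : Dual k A) (p r t : A) :
    sandwich l p r t = l (antipodeInv k A r * (t * p)) := rfl

/-- For fixed `l`, the map `p ⊗ q ⊗ r ↦ l (S⁻¹(r) - p) ⊗ q`. -/
def bicrossAux (l : Dual k A) : A ⊗[k] (A ⊗[k] A) →ₗ[k] Dual k A ⊗[k] A :=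
  (TensorProduct.lift (sandwich l)).rTensor A ∘ₗ
    (TensorProduct.assoc k A A A).symm.toLinearMap ∘ₗ
      (TensorProduct.comm k A A).toLinearMap.lTensor A

@[simp] lemma bicrossAux_tmul (l : Dual k A) (p q r : A) :
    bicrossAux l (p ⊗ₜ (q ⊗ₜ r)) = sandwich l p r ⊗ₜ q := rfl

variable (k A) in
/-- The iterated coproduct `y ↦ y₍₁₎ ⊗ y₍₂₎ ⊗ y₍₃₎` of `A`. -/
def comul₂ : A →ₗ[k] A ⊗[k] (A ⊗[k] A) :=
  (Coalgebra.comul : A →ₗ[k] A ⊗[k] A).lTensor A ∘ₗ Coalgebra.comul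

variable (k A) in
/-- The bicrossing map `A ⊗ A° → A° ⊗ A`,
`y ⊗ l ↦ ∑ l (S⁻¹(y₍₃₎) - y₍₁₎) ⊗ y₍₂₎`. -/
def bicross : A ⊗[k] Dual k A →ₗ[k] Dual k A ⊗[k] A :=
  TensorProduct.lift <| LinearMap.mk₂ k (fun y l => bicrossAux l (comul₂ k A y))
    (fun _ _ _ => by simp)
    (fun _ _ _ => by simp)
    (fun y l l' => by
      have h : bicrossAux (l + l') = bicrossAux l + bicrossAux l' := by
        ext p q r
        simp only [TensorProduct.AlgebraTensorModule.curry_apply, TensorProduct.curry_apply,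
          LinearMap.coe_restrictScalars, LinearMap.add_apply, bicrossAux_tmul,
          ← TensorProduct.add_tmul]
        rfl
      rw [h, LinearMap.add_apply])
    (fun c y l => by
      have h : bicrossAux (c • l) = c • bicrossAux l := by
        ext p q r
        simp only [TensorProduct.AlgebraTensorModule.curry_apply, TensorProduct.curry_apply,
          LinearMap.coe_restrictScalars, LinearMap.smul_apply, bicrossAux_tmul,
          TensorProduct.smul_tmul']
        rfl
      rw [h, LinearMap.smul_apply])

namespace Double

variable (k A) in
/-- The product of `D(A)` as a linear map:
`(l · y)(m · z) = ∑ l m_i · y_i z`, where `bicross (y ⊗ m) = ∑ m_i ⊗ y_i`. -/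
def mulMap : Double k A ⊗[k] Double k A →ₗ[k] Double k A :=
  TensorProduct.map (dualMul k A) (LinearMap.mul' k A) ∘ₗ
    (TensorProduct.assoc k (Dual k A) (Dual k A) (A ⊗[k] A)).symm.toLinearMap ∘ₗ
    ((TensorProduct.assoc k (Dual k A) A A).toLinearMap ∘ₗ
      (bicross k A).rTensor A ∘ₗ
      (TensorProduct.assoc k A (Dual k A) A).symm.toLinearMap).lTensor (Dual k A) ∘ₗ
    (TensorProduct.assoc k (Dual k A) A (Dual k A ⊗[k] A)).toLinearMap

/-- The product of `D(A)`. -/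
def mul (p q : Double k A) : Double k A := mulMap k A (p ⊗ₜ q)

variable (k A) in
/-- The unit of `D(A)`. -/
def one : Double k A := dualOne k A ⊗ₜ 1

variable (k A) in
/-- The inclusion `A → D(A)`. -/
def ofAlg : A →ₗ[k] Double k A := TensorProduct.mk k (Dual k A) A (dualOne k A)

variable (k A) in
/-- The inclusion `A° → D(A)`. -/
def ofDual : Dual k A →ₗ[k] Double k A := (TensorProduct.mk k (Dual k A) A).flip 1

variable (k A) in
/-- The coproduct of `D(A)`: `Δ(l · y) = ∑ (l₍₁₎ · y₍₁₎) ⊗ (l₍₂₎ · y₍₂₎)`, with the coproducts of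
`A°` and `A`. -/
def comul [FiniteDimensional k A] : Double k A →ₗ[k] Double k A ⊗[k] Double k A :=
  (TensorProduct.tensorTensorTensorComm k (Dual k A) (Dual k A) A A).toLinearMap ∘ₗ
    TensorProduct.map (dualComul k A) Coalgebra.comul

variable (k A) in
/-- The antipode of `D(A)`: `S(l · y) = S(y) · S(l)`, with the antipodes of `A` and `A°`. -/
def antipode : Double k A →ₗ[k] Double k A :=
  bicross k A ∘ₗ TensorProduct.map (HopfAlgebra.antipode k) (dualAntipode k A) ∘ₗ
    (TensorProduct.comm k (Dual k A) A).toLinearMap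

/-- The product of the algebra `D(A) ⊗ D(A)`: `(p ⊗ q)(p' ⊗ q') = p p' ⊗ q q'`. -/
def mul₂ (P Q : Double k A ⊗[k] Double k A) : Double k A ⊗[k] Double k A :=
  TensorProduct.map (mulMap k A) (mulMap k A)
    (TensorProduct.tensorTensorTensorComm k _ _ _ _ (P ⊗ₜ Q))

section

variable [FiniteDimensional k A]

variable (k A) in
/-- The universal R-matrix `R = ∑ e_i ⊗ f_i`, for dual bases `e_i` of `A` and `f_i` of `A°`. -/
def R : Double k A ⊗[k] Double k A :=
  TensorProduct.map (ofAlg k A) (ofDual k A) (coevaluation k A 1)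

variable (k A) in
/-- The monodromy element `M = τ(R) R = ∑ f_j e_i ⊗ e_j f_i`. -/
def M : Double k A ⊗[k] Double k A :=
  mul₂ (TensorProduct.comm k _ _ (R k A)) (R k A)

variable (k A) in
/-- The canonical element `u = ∑ S(f_i) e_i`. -/
def u : Double k A :=
  mulMap k A ((antipode k A).rTensor _ (TensorProduct.comm k _ _ (R k A)))

/-- `v` is a ribbon element of `D(A)` with two-sided inverse `w = v⁻¹`: it is central, fixed by the
antipode, and `M = (v ⊗ v) Δ(v⁻¹)`. -/
structure IsRibbonElement (v w : Double k A) : Prop where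
  mul_inv : mul v w = one k A
  inv_mul : mul w v = one k A
  central : ∀ y : Double k A, mul v y = mul y v
  antipode_eq : antipode k A v = v
  monodromy : M k A = mul₂ (v ⊗ₜ v) (comul k A w)

/-- The map `f̄ : D(A)* → D(A)`, `η ↦ (η ⊗ id)(M)`. -/
def fbar (η : Dual k (Double k A)) : Double k A :=
  TensorProduct.lid k _ (η.rTensor _ (M k A))

end

variable (k A) in
/-- The linear form `χ` on `D(A)` given by the contraction `χ(l · y) = l(y)`. -/
def chi : Dual k (Double k A) := contractLeft k A

/-- The right integral `μ_D` on `D(A)`: `μ_D(l · y) = l(x) μ(S(y))`. -/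
def integral (μ : Dual k A) (x : A) : Dual k (Double k A) :=
  LinearMap.mul' k k ∘ₗ
    TensorProduct.map (Module.Dual.eval k A x) (μ ∘ₗ HopfAlgebra.antipode k)

/-- The operator `𝒮(y) = S(f̄(μ_D(y -))) = ∑_{i,j} μ_D(y f_j e_i) S(e_j f_i)` on `D(A)`. -/
def modularS [FiniteDimensional k A] (μ : Dual k A) (x : A) (y : Double k A) : Double k A :=
  antipode k A (fbar (integral μ x ∘ₗ mulMap k A ∘ₗ TensorProduct.mk k _ _ y))

end Double

end QDouble

end

/-! Read `l ⊗ y` in D(A) as the endomorphism `t ↦ l(t) y` of `A`; by finite dimension this loses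
nothing. The product becomes `((l ⊗ y) Q)(t) = ∑ y₂ Q(S⁻¹(y₃) l(t₁) t₂ y₁)` (`hom_mul`), the
coproduct of `P` evaluates at `(t, s)` to `Δ(P(s t))` (`hom₂_comul`), and `u` is `S⁻¹` (`hom_u`).
Identities in the double thus become identities between linear maps on `A`.

In this picture `M Δ(u) = u ⊗ u` (`M_mul_comul_u`). With `Δ(w) = (w ⊗ w) M` it makes `b = w u`
group-like, which forces `b = β ⊗ g` with `β` a character and `g` a group-like element of `A`
(`exists_groupLike`). Hence `χ(b) = β(g)` and `ν = β(g)⁻¹`. Moreover `w = b u⁻¹` and `v = u b⁻¹`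
become explicit maps (`hom_w`, `hom_v`), and centrality expresses `S²` through `β` and `g`
(`antipode_antipode_eq`).

For `𝒮(w)`, the ribbon equation turns `(μ_D(w -) ⊗ id)(M)` into `v (μ_D ⊗ id)Δ(w) = μ_D(w) v`,
because `μ_D` is a right integral; `S(v) = v` finishes. For `𝒮(v)`, the identity `∑ x₁ μ(p x₂) =
S(p)` evaluates the integral directly and produces `β(g) w`.

What remains is scalar. One has `μ_D(w) = β(g)⁻¹ c` and `ω = c`, where `c = μ(S x)`, so everything
rests on `c = β(g)⁻⁴` (`apply_antipode_cointegral`). Evaluating `S(v) = v` at `x`, and comparing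
`S²(x) = c x` with the formula for `S²`, yields an equality of two functionals on `A`, which at `1`
and at `g` reads `α(g)² c = 1` and `α(g) = β(g)²`. -/

open scoped TensorProduct

noncomputable section

namespace QDouble

open Module (Dual)
open HopfAlgebra (antipode)
open Coalgebra (comul counit)

/-! ### Actions of the dual on `A`, and comatrix coefficients as a substitute for Sweedler notation
-/

section Hits

variable {k : Type*} [Field k] {A : Type*} [Ring A] [HopfAlgebra k A]

/-- `z ↦ φ(z₍₁₎) z₍₂₎`. -/
def lhit (φ : Dual k A) : A →ₗ[k] A :=
  (TensorProduct.lid k A).toLinearMap ∘ₗ φ.rTensor A ∘ₗ comul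

/-- `z ↦ z₍₁₎ φ(z₍₂₎)`. -/
def rhit (φ : Dual k A) : A →ₗ[k] A :=
  (TensorProduct.rid k A).toLinearMap ∘ₗ φ.lTensor A ∘ₗ comul

lemma comul_lhit (φ : Dual k A) (z : A) :
    comul (R := k) (lhit φ z) = (lhit φ).rTensor A (comul z) := by
  have h := Coalgebra.coassoc_apply (R := k) z
  have h2 : (lhit φ).rTensor A (comul (R := k) z) =
      TensorProduct.lid k (A ⊗[k] A) (φ.rTensor (A ⊗[k] A)
        (TensorProduct.assoc k A A A ((comul (R := k)).rTensor A (comul z)))) := by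
    generalize comul (R := k) z = w
    induction w with
    | zero => simp
    | add a b ha hb => simp only [map_add, ha, hb]
    | tmul a b =>
      simp only [lhit, LinearMap.rTensor_tmul, LinearMap.comp_apply]
      generalize comul (R := k) a = w
      induction w with
      | zero => simp
      | add a b ha hb => simp only [map_add, ha, hb, TensorProduct.add_tmul]
      | tmul a b => simp [TensorProduct.smul_tmul']
  rw [h2, h]
  simp only [lhit, LinearMap.comp_apply]
  generalize comul (R := k) z = w
  induction w with
  | zero => simp
  | add a b ha hb => simp only [map_add, ha, hb]
  | tmul a b => simp

@[simp] lemma counit_lhit (φ : Dual k A) (z : A) : counit (R := k) (lhit φ z) = φ z := by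
  have h := Coalgebra.lTensor_counit_comul (R := k) z
  have h2 : ∀ w : A ⊗[k] A, counit (R := k) (TensorProduct.lid k A (φ.rTensor A w)) =
      TensorProduct.lid k k (φ.rTensor k ((counit (R := k)).lTensor A w)) := by
    intro w
    induction w with
    | zero => simp
    | add a b ha hb => simp only [map_add, ha, hb]
    | tmul a b => simp
  simp only [lhit, LinearMap.comp_apply, LinearEquiv.coe_coe]
  rw [h2, h]; simp

@[simp] lemma counit_rhit (φ : Dual k A) (z : A) : counit (R := k) (rhit φ z) = φ z := by
  have h := Coalgebra.rTensor_counit_comul (R := k) z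
  have h2 : ∀ w : A ⊗[k] A, counit (R := k) (TensorProduct.rid k A (φ.lTensor A w)) =
      TensorProduct.rid k k (φ.lTensor k ((counit (R := k)).rTensor A w)) := by
    intro w
    induction w with
    | zero => simp
    | add a b ha hb => simp only [map_add, ha, hb]
    | tmul a b => simp
  simp only [rhit, LinearMap.comp_apply, LinearEquiv.coe_coe]
  rw [h2, h]; simp

lemma rhit_add (φ ψ : Dual k A) : rhit (φ + ψ) = rhit φ + rhit ψ := by
  ext z; simp [rhit, LinearMap.lTensor_add]

lemma rhit_smul (c : k) (φ : Dual k A) : rhit (c • φ) = c • rhit φ := by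
  ext z; simp [rhit, LinearMap.lTensor_smul]

variable (k A) in
/-- The comatrix coefficients of the regular comodule. -/
def cm [FiniteDimensional k A] (i j : Fin (Module.finrank k A)) : A :=
  lhit ((Module.finBasis k A).coord i) (Module.finBasis k A j)

variable [FiniteDimensional k A]

lemma tensor_expand {M : Type*} [AddCommGroup M] [Module k M] (z : A ⊗[k] M) :
    z = ∑ j, Module.finBasis k A j ⊗ₜ[k]
      TensorProduct.lid k M (((Module.finBasis k A).coord j).rTensor M z) := by
  induction z with
  | zero => simp
  | add a b ha hb =>
    simp only [map_add, TensorProduct.tmul_add, Finset.sum_add_distrib]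
    rw [← ha, ← hb]
  | tmul a m =>
    simp only [LinearMap.rTensor_tmul, TensorProduct.lid_tmul, ← TensorProduct.smul_tmul,
      ← TensorProduct.sum_tmul]
    congr 1
    simp

lemma comul_finBasis (j : Fin (Module.finrank k A)) :
    comul (R := k) (Module.finBasis k A j) = ∑ i, Module.finBasis k A i ⊗ₜ[k] cm k A i j :=
  tensor_expand _

@[simp] lemma comul_cm (i j : Fin (Module.finrank k A)) :
    comul (R := k) (cm k A i j) = ∑ l, cm k A i l ⊗ₜ[k] cm k A l j := by
  rw [cm, comul_lhit, comul_finBasis]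
  simp [cm]

@[simp] lemma counit_cm (i j : Fin (Module.finrank k A)) :
    counit (R := k) (cm k A i j) = if i = j then 1 else 0 := by
  rw [cm, counit_lhit]
  simp [Finsupp.single_apply, eq_comm]

lemma finBasis_eq_sum_cm (j : Fin (Module.finrank k A)) :
    Module.finBasis k A j = ∑ i, counit (R := k) (Module.finBasis k A i) • cm k A i j := by
  have h := Coalgebra.rTensor_counit_comul (R := k) (Module.finBasis k A j)
  have := congrArg (TensorProduct.lid k A) h
  simpa [comul_finBasis] using this.symm

/-- The coefficients span `A` by `finBasis_eq_sum_cm`. On them the coproduct is matrix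
multiplication and the counit is the identity matrix, so Sweedler computations reduce to exchanging
and contracting index sums. -/
lemma ext_cm {M : Type*} [AddCommGroup M] [Module k M] {f g : A →ₗ[k] M}
    (h : ∀ i j, f (cm k A i j) = g (cm k A i j)) : f = g := by
  refine (Module.finBasis k A).ext fun j => ?_
  rw [finBasis_eq_sum_cm j]
  simp [h]

lemma cm_induction {p : A → Prop} (y : A) (add : ∀ a b, p a → p b → p (a + b))
    (smul : ∀ (c : k) a, p a → p (c • a)) (mem : ∀ i j, p (cm k A i j)) (zero : p 0) : p y := by
  rw [← (Module.finBasis k A).sum_repr y]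
  refine Finset.sum_induction _ p add zero fun j _ => smul _ _ ?_
  rw [finBasis_eq_sum_cm j]
  exact Finset.sum_induction _ p add zero fun i _ => smul _ _ (mem _ _)

lemma lhit_cm (φ : Dual k A) (i j : Fin (Module.finrank k A)) :
    lhit φ (cm k A i j) = ∑ l, φ (cm k A i l) • cm k A l j := by
  simp [lhit]

lemma rhit_cm (φ : Dual k A) (i j : Fin (Module.finrank k A)) :
    rhit φ (cm k A i j) = ∑ l, φ (cm k A l j) • cm k A i l := by
  simp [rhit]

lemma lhit_rhit_comm (φ ψ : Dual k A) (z : A) : lhit φ (rhit ψ z) = rhit ψ (lhit φ z) := by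
  refine LinearMap.congr_fun (f := lhit φ ∘ₗ rhit ψ) (g := rhit ψ ∘ₗ lhit φ)
    (ext_cm fun i j => ?_) z
  simp only [LinearMap.comp_apply, lhit_cm, rhit_cm, map_sum, map_smul, Finset.smul_sum]
  rw [Finset.sum_comm]
  simp only [smul_smul, mul_comm]

lemma rhit_rhit (φ ψ : Dual k A) (z : A) : rhit φ (rhit ψ z) = rhit (ψ ∘ₗ lhit φ) z := by
  refine LinearMap.congr_fun (f := rhit φ ∘ₗ rhit ψ) (g := rhit (ψ ∘ₗ lhit φ))
    (ext_cm fun i j => ?_) z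
  simp only [LinearMap.comp_apply, lhit_cm, rhit_cm, map_sum, map_smul, Finset.smul_sum,
    Finset.sum_smul, smul_smul]
  rw [Finset.sum_comm]
  simp only [smul_eq_mul, mul_comm]

lemma lhit_lhit (φ ψ : Dual k A) (z : A) : lhit φ (lhit ψ z) = lhit (ψ ∘ₗ rhit φ) z := by
  refine LinearMap.congr_fun (f := lhit φ ∘ₗ lhit ψ) (g := lhit (ψ ∘ₗ rhit φ))
    (ext_cm fun i j => ?_) z
  simp only [LinearMap.comp_apply, lhit_cm, rhit_cm, map_sum, map_smul, Finset.smul_sum,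
    Finset.sum_smul, smul_smul]
  rw [Finset.sum_comm]
  simp only [smul_eq_mul, mul_comm]

lemma sum_antipode_mul_cm (i j : Fin (Module.finrank k A)) :
    ∑ l, antipode k (cm k A i l) * cm k A l j = if i = j then 1 else 0 := by
  have := HopfAlgebra.mul_antipode_rTensor_comul_apply (R := k) (cm k A i j)
  simpa [apply_ite] using this

lemma sum_mul_antipode_cm (i j : Fin (Module.finrank k A)) :
    ∑ l, cm k A i l * antipode k (cm k A l j) = if i = j then 1 else 0 := by
  have := HopfAlgebra.mul_antipode_lTensor_comul_apply (R := k) (cm k A i j)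
  simpa [apply_ite] using this

/-- Over `A ⊗ A`, the matrix `Δ(S(c))` is a left inverse of `Δ(c)` and the claimed right-hand side
is a right inverse, so they coincide. -/
lemma comul_antipode_cm (i j : Fin (Module.finrank k A)) :
    comul (R := k) (antipode k (cm k A i j)) =
      ∑ l, antipode k (cm k A l j) ⊗ₜ[k] antipode k (cm k A i l) := by
  let C : Matrix (Fin (Module.finrank k A)) (Fin (Module.finrank k A)) (A ⊗[k] A) :=
    fun i j => comul (R := k) (cm k A i j)
  let P : Matrix (Fin (Module.finrank k A)) (Fin (Module.finrank k A)) (A ⊗[k] A) :=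
    fun i j => comul (R := k) (antipode k (cm k A i j))
  let Q : Matrix (Fin (Module.finrank k A)) (Fin (Module.finrank k A)) (A ⊗[k] A) :=
    fun i j => ∑ l, antipode k (cm k A l j) ⊗ₜ[k] antipode k (cm k A i l)
  have h1 : P * C = 1 := by
    ext i j
    rw [Matrix.mul_apply, Matrix.one_apply]
    simp only [P, C, ← Bialgebra.comul_mul, ← map_sum, sum_antipode_mul_cm]
    split_ifs <;> simp
  have h2 : C * Q = 1 := by
    ext i j
    rw [Matrix.mul_apply]
    simp only [Q, C, comul_cm, Finset.sum_mul_sum,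
      Algebra.TensorProduct.tmul_mul_tmul]
    calc _ = ∑ p, ∑ q, (cm k A i p * antipode k (cm k A q j)) ⊗ₜ[k]
          (∑ l, cm k A p l * antipode k (cm k A l q)) := by
            simp only [TensorProduct.tmul_sum]
            conv_rhs => rw [Finset.sum_comm]
            rw [Finset.sum_comm]
            conv_rhs => rw [Finset.sum_comm]
            exact Finset.sum_congr rfl fun p _ => Finset.sum_comm
      _ = (1 : Matrix _ _ (A ⊗[k] A)) i j := by
            simp only [sum_mul_antipode_cm, TensorProduct.tmul_ite,
              Finset.sum_ite_eq, Finset.mem_univ, if_true, ← TensorProduct.sum_tmul,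
              Matrix.one_apply]
            split_ifs <;> simp [Algebra.TensorProduct.one_def]
  have h3 : P = Q := left_inv_eq_right_inv h1 h2
  exact congrFun (congrFun h3 i) j

lemma comul_antipode (z : A) : comul (R := k) (antipode k z) =
    TensorProduct.comm k A A (TensorProduct.map (antipode k) (antipode k) (comul z)) := by
  refine LinearMap.congr_fun (f := comul ∘ₗ antipode k)
    (g := (TensorProduct.comm k A A).toLinearMap ∘ₗ
      TensorProduct.map (antipode k) (antipode k) ∘ₗ comul) (ext_cm fun i j => ?_) z
  simp [comul_antipode_cm]

end Hits

/-! ### The inverse antipode -/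

section AntipodeInv

variable {k : Type*} [Field k] {A : Type*} [Ring A] [HopfAlgebra k A]
variable [hS : Fact (Function.Bijective (antipode k : A →ₗ[k] A))]

lemma isUnit_antipode : IsUnit (M := Module.End k A) (antipode k : A →ₗ[k] A) :=
  (Module.End.isUnit_iff _).mpr hS.out

@[simp] lemma antipodeInv_antipode (y : A) : antipodeInv k A (antipode k y) = y :=
  LinearMap.congr_fun (Ring.inverse_mul_cancel (M₀ := Module.End k A) _ isUnit_antipode) y

@[simp] lemma antipode_antipodeInv (y : A) : antipode k (antipodeInv k A y) = y :=
  LinearMap.congr_fun (Ring.mul_inverse_cancel (M₀ := Module.End k A) _ isUnit_antipode) y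

lemma antipodeInv_mul (y z : A) :
    antipodeInv k A (y * z) = antipodeInv k A z * antipodeInv k A y := by
  apply hS.out.1
  rw [HopfAlgebra.antipode_mul_antidistrib]
  simp

@[simp] lemma antipodeInv_one : antipodeInv k A 1 = 1 := by
  apply hS.out.1
  simp

@[simp] lemma counit_antipodeInv (y : A) : counit (R := k) (antipodeInv k A y) = counit y := by
  rw [← HopfAlgebra.counit_antipode]; simp

variable [FiniteDimensional k A]

lemma comul_antipodeInv_cm (i j : Fin (Module.finrank k A)) :
    comul (R := k) (antipodeInv k A (cm k A i j)) =
      ∑ l, antipodeInv k A (cm k A l j) ⊗ₜ[k] antipodeInv k A (cm k A i l) := by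
  have h := comul_antipode (k := k) (antipodeInv k A (cm k A i j))
  rw [antipode_antipodeInv, comul_cm] at h
  have h2 := congrArg (fun w => TensorProduct.map (antipodeInv k A) (antipodeInv k A)
    (TensorProduct.comm k A A w)) h
  have h3 : ∀ w : A ⊗[k] A, TensorProduct.map (antipodeInv k A) (antipodeInv k A)
    (TensorProduct.comm k A A (TensorProduct.comm k A A
      (TensorProduct.map (antipode k) (antipode k) w))) = w := by
    intro w
    induction w with
    | zero => simp
    | add a b ha hb => simp only [map_add, ha, hb]
    | tmul a b => simp
  simp only [h3] at h2
  rw [← h2]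
  simp

lemma sum_antipodeInv_mul_cm (i j : Fin (Module.finrank k A)) :
    ∑ l, antipodeInv k A (cm k A l j) * cm k A i l = if i = j then 1 else 0 := by
  have := congrArg (antipodeInv k A) (sum_antipode_mul_cm (k := k) (A := A) i j)
  simpa [antipodeInv_mul, apply_ite] using this

lemma sum_mul_antipodeInv_cm (i j : Fin (Module.finrank k A)) :
    ∑ l, cm k A l j * antipodeInv k A (cm k A i l) = if i = j then 1 else 0 := by
  have := congrArg (antipodeInv k A) (sum_mul_antipode_cm (k := k) (A := A) i j)
  simpa [antipodeInv_mul, apply_ite] using this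

end AntipodeInv

end QDouble

namespace QDouble

open Module (Dual)
open HopfAlgebra (antipode)
open Coalgebra (comul counit)

/-! ### Characters, and their interaction with the two actions -/

section Characters

variable {k : Type*} [Field k] {A : Type*} [Ring A] [HopfAlgebra k A]

@[simp] lemma rhit_counit (z : A) : rhit (counit (R := k)) z = z := by
  simp [rhit]

@[simp] lemma lhit_counit (z : A) : lhit (counit (R := k)) z = z := by
  simp [lhit]

/-- The convolution inverse of a character. -/
def charInv (β : A →ₐ[k] k) : A →ₐ[k] k :=
  AlgHom.ofLinearMap (β.toLinearMap ∘ₗ antipode k) (by simp)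
    (by simp [HopfAlgebra.antipode_mul_antidistrib, mul_comm])

lemma charInv_apply (β : A →ₐ[k] k) (z : A) : charInv β z = β (antipode k z) := rfl

lemma apply_rhit (φ ψ : Dual k A) (z : A) : ψ (rhit φ z) = φ (lhit ψ z) := by
  simp only [rhit, lhit, LinearMap.comp_apply, LinearEquiv.coe_coe]
  generalize comul (R := k) z = w
  induction w with
  | zero => simp
  | add a b ha hb => simp only [map_add, ha, hb]
  | tmul a b => simp [mul_comm]

lemma lhit_mul (β : A →ₐ[k] k) (y z : A) :
    lhit β.toLinearMap (y * z) = lhit β.toLinearMap y * lhit β.toLinearMap z := by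
  simp only [lhit, LinearMap.comp_apply, LinearEquiv.coe_coe, Bialgebra.comul_mul]
  generalize comul (R := k) z = w
  generalize comul (R := k) y = v
  induction v with
  | zero => simp
  | add a b ha hb => simp only [map_add, ha, hb, add_mul]
  | tmul a b =>
    induction w with
    | zero => simp
    | add a b ha hb => simp only [map_add, ha, hb, mul_add]
    | tmul a b => simp [smul_smul, mul_comm]

lemma rhit_mul (β : A →ₐ[k] k) (y z : A) :
    rhit β.toLinearMap (y * z) = rhit β.toLinearMap y * rhit β.toLinearMap z := by
  simp only [rhit, LinearMap.comp_apply, LinearEquiv.coe_coe, Bialgebra.comul_mul]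
  generalize comul (R := k) z = w
  generalize comul (R := k) y = v
  induction v with
  | zero => simp
  | add a b ha hb => simp only [map_add, ha, hb, add_mul]
  | tmul a b =>
    induction w with
    | zero => simp
    | add a b ha hb => simp only [map_add, ha, hb, mul_add]
    | tmul a b => simp [smul_smul, mul_comm]

lemma lhit_groupLike (φ : Dual k A) {g : A} (hg : comul (R := k) g = g ⊗ₜ g) :
    lhit φ g = φ g • g := by
  simp [lhit, hg]

lemma rhit_groupLike (φ : Dual k A) {g : A} (hg : comul (R := k) g = g ⊗ₜ g) :
    rhit φ g = φ g • g := by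
  simp [rhit, hg]

variable [FiniteDimensional k A]

lemma lhit_antipode (φ : Dual k A) (z : A) :
    lhit φ (antipode k z) = antipode k (rhit (φ ∘ₗ antipode k) z) := by
  simp only [rhit, lhit, LinearMap.comp_apply, LinearEquiv.coe_coe, comul_antipode]
  generalize comul (R := k) z = w
  induction w with
  | zero => simp
  | add a b ha hb => simp only [map_add, ha, hb]
  | tmul a b => simp

lemma rhit_antipode (φ : Dual k A) (z : A) :
    rhit φ (antipode k z) = antipode k (lhit (φ ∘ₗ antipode k) z) := by
  simp only [rhit, lhit, LinearMap.comp_apply, LinearEquiv.coe_coe, comul_antipode]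
  generalize comul (R := k) z = w
  induction w with
  | zero => simp
  | add a b ha hb => simp only [map_add, ha, hb]
  | tmul a b => simp

@[simp] lemma rhit_charInv_rhit (β : A →ₐ[k] k) (z : A) :
    rhit (charInv β).toLinearMap (rhit β.toLinearMap z) = z := by
  rw [rhit_rhit]
  convert rhit_counit (k := k) z
  refine ext_cm fun i j => ?_
  simp only [LinearMap.comp_apply, lhit_cm, AlgHom.toLinearMap_apply, map_sum, map_smul,
    charInv_apply, smul_eq_mul, ← map_mul]
  rw [← map_sum, sum_antipode_mul_cm]
  simp [apply_ite]

@[simp] lemma rhit_rhit_charInv (β : A →ₐ[k] k) (z : A) :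
    rhit β.toLinearMap (rhit (charInv β).toLinearMap z) = z := by
  rw [rhit_rhit]
  convert rhit_counit (k := k) z
  refine ext_cm fun i j => ?_
  simp only [LinearMap.comp_apply, lhit_cm, AlgHom.toLinearMap_apply, map_sum, map_smul,
    charInv_apply, smul_eq_mul, ← map_mul]
  rw [← map_sum, sum_mul_antipode_cm]
  simp [apply_ite]

@[simp] lemma lhit_charInv_lhit (β : A →ₐ[k] k) (z : A) :
    lhit (charInv β).toLinearMap (lhit β.toLinearMap z) = z := by
  rw [lhit_lhit]
  convert lhit_counit (k := k) z
  refine ext_cm fun i j => ?_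
  simp only [LinearMap.comp_apply, rhit_cm, AlgHom.toLinearMap_apply, map_sum, map_smul,
    charInv_apply, smul_eq_mul]
  simp_rw [mul_comm]
  simp only [← map_mul]
  rw [← map_sum, sum_mul_antipode_cm]
  simp [apply_ite]

-- Both `β` and the double inverse are convolution inverses of `charInv β`. In particular `β ∘ S² =
-- β`, so `S⁻¹` can replace `S` in the inverse of a character.
@[simp] lemma charInv_charInv (β : A →ₐ[k] k) : charInv (charInv β) = β := by
  ext z
  have h := counit_rhit (charInv (charInv β)).toLinearMap
    (rhit (charInv β).toLinearMap (rhit β.toLinearMap z))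
  rw [rhit_charInv_rhit (charInv β), counit_rhit, rhit_charInv_rhit β] at h
  exact h.symm

variable [hS : Fact (Function.Bijective (antipode k : A →ₗ[k] A))]

lemma apply_antipodeInv (β : A →ₐ[k] k) (z : A) : β (antipodeInv k A z) = charInv β z := by
  have h := charInv_apply (charInv β) (antipodeInv k A z)
  rwa [charInv_charInv, antipode_antipodeInv] at h

lemma comul_antipodeInv (z : A) : comul (R := k) (antipodeInv k A z) =
    TensorProduct.comm k A A (TensorProduct.map (antipodeInv k A) (antipodeInv k A) (comul z)) := by
  refine LinearMap.congr_fun (f := comul ∘ₗ antipodeInv k A)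
    (g := (TensorProduct.comm k A A).toLinearMap ∘ₗ
      TensorProduct.map (antipodeInv k A) (antipodeInv k A) ∘ₗ comul) (ext_cm fun i j => ?_) z
  simp [comul_antipodeInv_cm]

lemma lhit_antipodeInv (φ : Dual k A) (z : A) :
    lhit φ (antipodeInv k A z) = antipodeInv k A (rhit (φ ∘ₗ antipodeInv k A) z) := by
  simp only [rhit, lhit, LinearMap.comp_apply, LinearEquiv.coe_coe, comul_antipodeInv]
  generalize comul (R := k) z = w
  induction w with
  | zero => simp
  | add a b ha hb => simp only [map_add, ha, hb]
  | tmul a b => simp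

end Characters

/-! ### Integrals and cointegrals of `A` -/

section Integrals

variable {k : Type*} [Field k] {A : Type*} [Ring A] [HopfAlgebra k A]

lemma antipode_cointegral_mul (hS : Function.Bijective (antipode k : A →ₗ[k] A))
    {x : A} (hx : IsLeftCointegral k x) (h : A) :
    antipode k x * h = counit (R := k) h • antipode k x := by
  obtain ⟨h, rfl⟩ := hS.2 h
  rw [← HopfAlgebra.antipode_mul_antidistrib, hx h]
  simp

variable [FiniteDimensional k A]

/-- In Sweedler form this is `z₁ μ(p z₂) = S(p₁) μ(p₂ z)`: replace `μ(p₂ z) 1` by `p₂ z₁ μ(p₃ z₂)`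
using invariance and cancel `S(p₁) p₂`. -/
lemma IsLeftIntegral.rhit_mulLeft {μ : Dual k A} (hμ : IsLeftIntegral μ) (p z : A) :
    rhit (μ ∘ₗ LinearMap.mulLeft k p) z = antipode k (rhit (μ ∘ₗ LinearMap.mulRight k z) p) := by
  have hμ' : ∀ h, rhit μ h = μ h • (1 : A) := hμ
  induction p using cm_induction (k := k) (A := A) with
  | add a b ha hb =>
    have : μ ∘ₗ LinearMap.mulLeft k (a + b) =
        μ ∘ₗ LinearMap.mulLeft k a + μ ∘ₗ LinearMap.mulLeft k b := by ext; simp [add_mul]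
    rw [this, rhit_add, LinearMap.add_apply, ha, hb, map_add, map_add]
  | smul c a ha =>
    have : μ ∘ₗ LinearMap.mulLeft k (c • a) = c • (μ ∘ₗ LinearMap.mulLeft k a) := by ext; simp
    rw [this, rhit_smul, LinearMap.smul_apply, ha, map_smul, map_smul]
  | zero =>
    have : μ ∘ₗ LinearMap.mulLeft k (0 : A) = 0 := by ext; simp
    rw [this]; simp [rhit]
  | mem i j =>
    induction z using cm_induction (k := k) (A := A) with
    | add a b ha hb =>
      have : μ ∘ₗ LinearMap.mulRight k (a + b) =
          μ ∘ₗ LinearMap.mulRight k a + μ ∘ₗ LinearMap.mulRight k b := by ext; simp [mul_add]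
      rw [this, rhit_add, LinearMap.add_apply, map_add, map_add, ha, hb]
    | smul c a ha =>
      have : μ ∘ₗ LinearMap.mulRight k (c • a) = c • (μ ∘ₗ LinearMap.mulRight k a) := by
        ext; simp
      rw [this, rhit_smul, LinearMap.smul_apply, map_smul, map_smul, ha]
    | zero =>
      have : μ ∘ₗ LinearMap.mulRight k (0 : A) = 0 := by ext; simp
      rw [this]; simp [rhit]
    | mem p q =>
      have h1 : ∀ a, μ (cm k A a j * cm k A p q) • (1 : A) = ∑ b, ∑ m,
          μ (cm k A b j * cm k A m q) • (cm k A a b * cm k A p m) := by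
        intro a
        rw [← hμ', rhit]
        simp [Finset.sum_mul_sum]
      simp only [rhit_cm, map_sum, map_smul, LinearMap.comp_apply, LinearMap.mulLeft_apply,
        LinearMap.mulRight_apply]
      calc _ = ∑ b, ∑ m, μ (cm k A b j * cm k A m q) •
            ((∑ a, antipode k (cm k A i a) * cm k A a b) * cm k A p m) := by
              simp [sum_antipode_mul_cm]
        _ = ∑ a, antipode k (cm k A i a) * (μ (cm k A a j * cm k A p q) • (1 : A)) := by
              simp only [h1, Finset.mul_sum, Finset.sum_mul, Finset.smul_sum, mul_smul_comm,
                mul_assoc]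
              conv_rhs => rw [Finset.sum_comm]
              refine Finset.sum_congr rfl fun b _ => ?_
              rw [Finset.sum_comm]
        _ = _ := by simp

variable {μ : Dual k A} {x : A}

/-- For a cointegral `y`, the functional `μ(- y)` is a multiple of the counit. At `y = x` the
antipode is recovered from `μ` and `x`, which is the main tool for computing with integrals below.
-/
lemma IsLeftIntegral.rhit_mulLeft_cointegral (hμ : IsLeftIntegral μ) {y : A}
    (hy : IsLeftCointegral k y) (p : A) :
    rhit (μ ∘ₗ LinearMap.mulLeft k p) y = μ y • antipode k p := by
  rw [hμ.rhit_mulLeft]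
  have : μ ∘ₗ LinearMap.mulRight k y = μ y • counit := by
    ext h; simp [hy h, mul_comm]
  rw [this, rhit_smul]; simp

lemma IsLeftIntegral.lhit_antipode (hS : Function.Bijective (antipode k : A →ₗ[k] A))
    (hμ : IsLeftIntegral μ) (z : A) :
    lhit (μ ∘ₗ antipode k) z = μ (antipode k z) • (1 : A) := by
  have hμ' : rhit μ (antipode k z) = μ (antipode k z) • (1 : A) := hμ _
  rw [rhit_antipode] at hμ'
  apply hS.1
  simpa using hμ'

/-- The map `φ ↦ x₁ φ(x₂)` is onto, since `μ(p -)` goes to `S(p)` and `S` is onto; equal dimensions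
then give injectivity. -/
lemma rhit_injective (hS : Function.Bijective (antipode k : A →ₗ[k] A)) (hμ : IsLeftIntegral μ)
    (hx : IsLeftCointegral k x) (hμx : μ x = 1) {φ ψ : Dual k A} (h : rhit φ x = rhit ψ x) :
    φ = ψ := by
  let F : Dual k A →ₗ[k] A :=
    { toFun := fun φ => rhit φ x
      map_add' := fun _ _ => by rw [rhit_add]; rfl
      map_smul' := fun _ _ => by rw [rhit_smul]; rfl }
  have hF : Function.Surjective F := fun y => by
    obtain ⟨p, rfl⟩ := hS.2 y
    exact ⟨μ ∘ₗ LinearMap.mulLeft k p, by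
      simpa [hμx, F] using hμ.rhit_mulLeft_cointegral hx p⟩
  exact (LinearMap.injective_iff_surjective_of_finrank_eq_finrank
    (Subspace.dual_finrank_eq)).mpr hF h

variable [hS : Fact (Function.Bijective (antipode k : A →ₗ[k] A))]

/-- Nondegeneracy of `(p, z) ↦ μ(p z)` makes cointegrals unique up to scale: `μ(- y)` and `μ(y) μ(-
x)` are both `μ(y)` times the counit. -/
lemma IsLeftCointegral.eq_smul (hμ : IsLeftIntegral μ)
    (hx : IsLeftCointegral k x) (hμx : μ x = 1) {y : A} (hy : IsLeftCointegral k y) :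
    y = μ y • x := by
  let G : A →ₗ[k] Dual k A :=
    { toFun := fun z => μ ∘ₗ LinearMap.mulRight k z
      map_add' := fun _ _ => by ext; simp [mul_add]
      map_smul' := fun _ _ => by ext; simp }
  have hG : Function.Surjective G := fun φ => by
    -- Applying `φ ∘ S⁻¹` to `x₁ μ(p x₂) = S(p)` gives `φ(p) = μ(p z)` for this `z`.
    refine ⟨lhit (φ ∘ₗ antipodeInv k A) x, ?_⟩
    ext p
    have h := congrArg (φ ∘ₗ antipodeInv k A) (hμ.rhit_mulLeft_cointegral hx p)
    rw [apply_rhit, hμx] at h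
    simpa [G] using h
  have hinj : Function.Injective G := (LinearMap.injective_iff_surjective_of_finrank_eq_finrank
    (Subspace.dual_finrank_eq).symm).mpr hG
  apply hinj
  ext p
  have h1 := congrArg (counit (R := k)) (hμ.rhit_mulLeft_cointegral hx p)
  have h2 := congrArg (counit (R := k)) (hμ.rhit_mulLeft_cointegral hy p)
  rw [counit_rhit] at h1 h2
  simp [hμx] at h1 h2
  simp [G, h1, h2]

/-- The modulus, as a character. -/
def modulus (hμ : IsLeftIntegral μ) (hx : IsLeftCointegral k x) (hμx : μ x = 1) : A →ₐ[k] k :=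
  have key : ∀ h, x * h = μ (x * h) • x := fun h =>
    IsLeftCointegral.eq_smul hμ hx hμx fun p => by rw [← mul_assoc, hx p, smul_mul_assoc]
  AlgHom.ofLinearMap (μ ∘ₗ LinearMap.mulLeft k x) (by simp [hμx]) (fun a b => by
    simp only [LinearMap.comp_apply, LinearMap.mulLeft_apply]
    rw [← mul_assoc, key a, smul_mul_assoc, map_smul, smul_eq_mul]
    simp [hμx])

lemma mul_eq_modulus_smul (hμ : IsLeftIntegral μ) (hx : IsLeftCointegral k x) (hμx : μ x = 1)
    (h : A) : x * h = modulus hμ hx hμx h • x :=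
  IsLeftCointegral.eq_smul hμ hx hμx fun p => by rw [← mul_assoc, hx p, smul_mul_assoc]

lemma antipode_cointegral (hμ : IsLeftIntegral μ) (hx : IsLeftCointegral k x) (hμx : μ x = 1) :
    antipode k x = rhit (modulus hμ hx hμx).toLinearMap x := by
  have := hμ.rhit_mulLeft_cointegral hx x
  rw [hμx, one_smul] at this
  exact this.symm

/-- Take `p = S(x)` in `x₁ μ(p x₂) = S(p)`: since `S(x)` is a right cointegral, `μ(S(x) -)` is `μ(S
x)` times the counit. -/
lemma antipode_antipode_cointegral (hμ : IsLeftIntegral μ) (hx : IsLeftCointegral k x)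
    (hμx : μ x = 1) : antipode k (antipode k x) = μ (antipode k x) • x := by
  have := hμ.rhit_mulLeft_cointegral hx (antipode k x)
  rw [hμx, one_smul] at this
  rw [← this]
  have h2 : μ ∘ₗ LinearMap.mulLeft k (antipode k x) = μ (antipode k x) • counit := by
    ext h; simp [antipode_cointegral_mul hS.out hx h, mul_comm]
  rw [h2, rhit_smul]; simp

end Integrals

end QDouble

namespace QDouble

open Module (Dual)
open Coalgebra (counit)

/-! ### The algebra D(A), viewed inside the endomorphisms of `A` -/

section

variable {k : Type*} [Field k] {A : Type*} [Ring A] [HopfAlgebra k A]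

lemma dualMul_apply_left (l m : Dual k A) (t : A) :
    dualMul k A (l ⊗ₜ m) t = m (lhit l t) := by
  simp only [dualMul, lhit, LinearMap.comp_apply, LinearEquiv.coe_coe, LinearMap.dualMap_apply]
  generalize Coalgebra.comul (R := k) t = w
  induction w using TensorProduct.induction_on with
  | zero => simp
  | add a b ha hb => simp only [map_add, ha, hb]
  | tmul a b => simp

lemma dualMul_eq (l m : Dual k A) : dualMul k A (l ⊗ₜ m) = l ∘ₗ rhit m := by
  ext t
  rw [dualMul_apply_left, LinearMap.comp_apply, apply_rhit]

namespace Double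

lemma hom_tmul (l : Dual k A) (y t : A) : dualTensorHom k A A (l ⊗ₜ[k] y) t = l t • y := rfl

lemma mul_add' (P Q T : Double k A) : mul P (Q + T) = mul P Q + mul P T := by
  simp [mul, TensorProduct.tmul_add]

lemma add_mul' (P Q T : Double k A) : mul (P + Q) T = mul P T + mul Q T := by
  simp [mul, TensorProduct.add_tmul]

lemma zero_mul' (P : Double k A) : mul 0 P = 0 := by
  simp [mul]

lemma mul_zero' (P : Double k A) : mul P 0 = 0 := by
  simp [mul]

lemma smul_mul' (c : k) (P Q : Double k A) : mul (c • P) Q = c • mul P Q := by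
  simp only [mul, ← TensorProduct.smul_tmul', map_smul]

lemma mul_smul' (c : k) (P Q : Double k A) : mul P (c • Q) = c • mul P Q := by
  simp only [mul, TensorProduct.tmul_smul, map_smul]

lemma sum_mul' {ι : Type*} (s : Finset ι) (P : ι → Double k A) (Q : Double k A) :
    mul (∑ i ∈ s, P i) Q = ∑ i ∈ s, mul (P i) Q := by
  simp [mul, TensorProduct.sum_tmul]

lemma mul_tmul_tmul {ι : Type*} {s : Finset ι} {y : A} {p q r : ι → A}
    (h : comul₂ k A y = ∑ a ∈ s, p a ⊗ₜ (q a ⊗ₜ r a)) (l m : Dual k A) (z : A) :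
    mul (l ⊗ₜ y) (m ⊗ₜ z) =
      ∑ a ∈ s, dualMul k A (l ⊗ₜ sandwich m (p a) (r a)) ⊗ₜ (q a * z) := by
  simp [mul, mulMap, bicross, h, TensorProduct.sum_tmul, TensorProduct.tmul_sum]

/-- The working form of the product: left multiplication by `l ⊗ y` hits the argument by `l`,
conjugates it by the outer legs of `y`, and multiplies the value by the middle leg. -/
lemma hom_mul {ι : Type*} {s : Finset ι} {y : A} {p q r : ι → A}
    (h : comul₂ k A y = ∑ a ∈ s, p a ⊗ₜ (q a ⊗ₜ r a)) (l : Dual k A) (Q : Double k A) (t : A) :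
    dualTensorHom k A A (mul (l ⊗ₜ y) Q) t =
      ∑ a ∈ s, q a * dualTensorHom k A A Q (antipodeInv k A (r a) * (lhit l t * p a)) := by
  induction Q using TensorProduct.induction_on with
  | zero => simp [mul_zero']
  | add P Q hP hQ =>
    simp only [mul_add', map_add, LinearMap.add_apply, hP, hQ, mul_add, Finset.sum_add_distrib]
  | tmul m z =>
    rw [mul_tmul_tmul h]
    simp [dualMul_apply_left]

lemma comul₂_one : comul₂ k A 1 = ∑ _a : Unit, (1 : A) ⊗ₜ[k] ((1 : A) ⊗ₜ[k] (1 : A)) := by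
  simp [comul₂, Algebra.TensorProduct.one_def]

lemma mul₂_tmul (P P' Q Q' : Double k A) :
    mul₂ (P ⊗ₜ P') (Q ⊗ₜ Q') = mul P Q ⊗ₜ mul P' Q' := rfl

lemma mul₂_add (P Q T : Double k A ⊗[k] Double k A) : mul₂ P (Q + T) = mul₂ P Q + mul₂ P T := by
  simp only [mul₂, TensorProduct.tmul_add, map_add]

lemma add_mul₂ (P Q T : Double k A ⊗[k] Double k A) : mul₂ (P + Q) T = mul₂ P T + mul₂ Q T := by
  simp only [mul₂, TensorProduct.add_tmul, map_add]

lemma zero_mul₂ (P : Double k A ⊗[k] Double k A) : mul₂ 0 P = 0 := by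
  simp only [mul₂, TensorProduct.zero_tmul, map_zero]

lemma mul₂_zero (P : Double k A ⊗[k] Double k A) : mul₂ P 0 = 0 := by
  simp only [mul₂, TensorProduct.tmul_zero, map_zero]

lemma smul_mul₂ (c : k) (P Q : Double k A ⊗[k] Double k A) : mul₂ (c • P) Q = c • mul₂ P Q := by
  simp only [mul₂, ← TensorProduct.smul_tmul', map_smul]

lemma sum_mul₂ {ι : Type*} (s : Finset ι) (P : ι → Double k A ⊗[k] Double k A)
    (Q : Double k A ⊗[k] Double k A) : mul₂ (∑ i ∈ s, P i) Q = ∑ i ∈ s, mul₂ (P i) Q := by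
  simp only [mul₂, TensorProduct.sum_tmul, map_sum]

lemma mul₂_sum {ι : Type*} (s : Finset ι) (P : ι → Double k A ⊗[k] Double k A)
    (Q : Double k A ⊗[k] Double k A) : mul₂ Q (∑ i ∈ s, P i) = ∑ i ∈ s, mul₂ Q (P i) := by
  simp only [mul₂, TensorProduct.tmul_sum, map_sum]

variable [FiniteDimensional k A]

lemma hom_ext {P Q : Double k A}
    (h : ∀ t, dualTensorHom k A A P t = dualTensorHom k A A Q t) : P = Q :=
  (dualTensorHom_bijective (R := k) (M := A) (N := A)).1 (LinearMap.ext h)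

lemma comul₂_cm (i j : Fin (Module.finrank k A)) : comul₂ k A (cm k A i j) =
    ∑ a : Fin (Module.finrank k A) × Fin (Module.finrank k A),
      cm k A i a.1 ⊗ₜ (cm k A a.1 a.2 ⊗ₜ cm k A a.2 j) := by
  simp [comul₂, TensorProduct.tmul_sum, Fintype.sum_prod_type]

lemma comul₂_mul_cm (i j i' j' : Fin (Module.finrank k A)) :
    comul₂ k A (cm k A i j * cm k A i' j') =
    ∑ a : (Fin (Module.finrank k A) × Fin (Module.finrank k A)) ×
        (Fin (Module.finrank k A) × Fin (Module.finrank k A)),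
      (cm k A i a.1.1 * cm k A i' a.2.1) ⊗ₜ ((cm k A a.1.1 a.1.2 * cm k A a.2.1 a.2.2) ⊗ₜ
        (cm k A a.1.2 j * cm k A a.2.2 j')) := by
  simp only [comul₂, LinearMap.comp_apply, Bialgebra.comul_mul, comul_cm, Finset.sum_mul_sum,
    Algebra.TensorProduct.tmul_mul_tmul, map_sum, LinearMap.lTensor_tmul, TensorProduct.tmul_sum,
    Fintype.sum_prod_type]
  refine Finset.sum_congr rfl fun a _ => ?_
  rw [Finset.sum_comm]

variable [hS : Fact (Function.Bijective (HopfAlgebra.antipode k : A →ₗ[k] A))]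

/-- Moving a hit past the conjugation of `hom_mul` is the one commutation needed for associativity.
-/
lemma lhit_conj_cm (m : Dual k A) (t : A) (i j p q : Fin (Module.finrank k A)) :
    lhit m (antipodeInv k A (cm k A q j) * (t * cm k A i p)) =
      ∑ a : Fin (Module.finrank k A) × Fin (Module.finrank k A),
        antipodeInv k A (cm k A q a.2) *
          (lhit (sandwich m (cm k A i a.1) (cm k A a.2 j)) t * cm k A a.1 p) := by
  simp only [lhit, LinearMap.comp_apply, LinearEquiv.coe_coe, Bialgebra.comul_mul,
    comul_antipodeInv_cm, comul_cm]
  generalize Coalgebra.comul (R := k) t = w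
  induction w using TensorProduct.induction_on with
  | zero => simp
  | add a b ha hb => simp only [map_add, add_mul, mul_add, ha, hb, Finset.sum_add_distrib]
  | tmul a b => simp [Finset.mul_sum, Finset.sum_mul, Fintype.sum_prod_type]

lemma mul_assoc' (P Q T : Double k A) : mul (mul P Q) T = mul P (mul Q T) := by
  induction P using TensorProduct.induction_on with
  | zero => simp [zero_mul']
  | add P P' hP hP' => simp only [add_mul', hP, hP']
  | tmul l y =>
    induction Q using TensorProduct.induction_on with
    | zero => simp [zero_mul', mul_zero']
    | add P P' hP hP' => simp only [add_mul', mul_add', hP, hP']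
    | tmul m z =>
      induction y using cm_induction (k := k) (A := A) with
      | add a b ha hb => simp only [TensorProduct.tmul_add, add_mul', ha, hb]
      | smul c a ha => simp only [TensorProduct.tmul_smul, smul_mul', ha]
      | zero => simp [zero_mul']
      | mem i j =>
        induction z using cm_induction (k := k) (A := A) with
        | add a b ha hb => simp only [TensorProduct.tmul_add, add_mul', mul_add', ha, hb]
        | smul c a ha => simp only [TensorProduct.tmul_smul, smul_mul', mul_smul', ha]
        | zero => simp [zero_mul', mul_zero']
        | mem i' j' =>
          refine hom_ext fun t => ?_
          rw [mul_tmul_tmul (comul₂_cm i j), sum_mul', map_sum, LinearMap.sum_apply,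
            hom_mul (comul₂_cm i j)]
          simp only [hom_mul (comul₂_cm i' j'), hom_mul (comul₂_mul_cm _ _ i' j'), dualMul_eq,
            ← lhit_lhit, lhit_conj_cm, antipodeInv_mul, Fintype.sum_prod_type (α₁ := _ × _),
            Finset.mul_sum, Finset.sum_mul, map_sum]
          rw [Finset.sum_comm]
          refine Finset.sum_congr rfl fun a _ => ?_
          rw [Finset.sum_comm]
          simp only [mul_assoc]

lemma one_mul' (Q : Double k A) : mul (one k A) Q = Q := by
  refine hom_ext fun t => ?_
  rw [one, hom_mul comul₂_one, dualOne]
  simp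

lemma mul_one' (P : Double k A) : mul P (one k A) = P := by
  induction P using TensorProduct.induction_on with
  | zero => simp [zero_mul']
  | add P P' hP hP' => simp only [add_mul', hP, hP']
  | tmul l y =>
    induction y using cm_induction (k := k) (A := A) with
    | add a b ha hb => simp only [TensorProduct.tmul_add, add_mul', ha, hb]
    | smul c a ha => simp only [TensorProduct.tmul_smul, smul_mul', ha]
    | zero => simp [zero_mul']
    | mem i j =>
      refine hom_ext fun t => ?_
      rw [hom_mul (comul₂_cm i j), one, dualOne]
      simp [hom_tmul, Fintype.sum_prod_type, -dualTensorHom_apply]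

lemma mul₂_assoc (P Q T : Double k A ⊗[k] Double k A) :
    mul₂ (mul₂ P Q) T = mul₂ P (mul₂ Q T) := by
  induction P using TensorProduct.induction_on with
  | zero => simp only [zero_mul₂]
  | add P P' hP hP' => simp only [add_mul₂, hP, hP']
  | tmul a b =>
    induction Q using TensorProduct.induction_on with
    | zero => simp only [zero_mul₂, mul₂_zero]
    | add P P' hP hP' => simp only [add_mul₂, mul₂_add, hP, hP']
    | tmul c d =>
      induction T using TensorProduct.induction_on with
      | zero => simp only [mul₂_zero]
      | add P P' hP hP' => simp only [mul₂_add, hP, hP']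
      | tmul c d => simp only [mul₂_tmul, mul_assoc']

end Double

end

end QDouble

namespace QDouble

open Module (Dual)
open Coalgebra (counit)

namespace Double

/-! ### The coproduct of D(A) and its multiplicativity -/

section

variable {k : Type*} [Field k] {A : Type*} [Ring A] [HopfAlgebra k A]

variable (k A) in
/-- Evaluation of an element of `D(A) ⊗ D(A)` at two elements of `A`. -/
def hom₂ : A →ₗ[k] A →ₗ[k] Double k A ⊗[k] Double k A →ₗ[k] A ⊗[k] A :=
  (TensorProduct.mapBilinear (RingHom.id k) (Double k A) (Double k A) A A).compl₁₂
    (dualTensorHom k A A).flip (dualTensorHom k A A).flip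

lemma hom₂_tmul (t s : A) (P Q : Double k A) : hom₂ k A t s (P ⊗ₜ Q) =
    dualTensorHom k A A P t ⊗ₜ dualTensorHom k A A Q s := rfl

lemma hom₂_mul₂ {ι κ : Type*} {s : Finset ι} {s' : Finset κ} {y y' : A} {p q r : ι → A}
    {p' q' r' : κ → A} (h : comul₂ k A y = ∑ a ∈ s, p a ⊗ₜ (q a ⊗ₜ r a))
    (h' : comul₂ k A y' = ∑ a ∈ s', p' a ⊗ₜ (q' a ⊗ₜ r' a)) (l l' : Dual k A)
    (X : Double k A ⊗[k] Double k A) (t t' : A) :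
    hom₂ k A t t' (mul₂ ((l ⊗ₜ y) ⊗ₜ (l' ⊗ₜ y')) X) = ∑ a ∈ s, ∑ b ∈ s', (q a ⊗ₜ q' b) *
      hom₂ k A (antipodeInv k A (r a) * (lhit l t * p a))
        (antipodeInv k A (r' b) * (lhit l' t' * p' b)) X := by
  induction X using TensorProduct.induction_on with
  | zero => simp [mul₂_zero]
  | add P Q hP hQ => simp only [mul₂_add, map_add, hP, hQ, mul_add, Finset.sum_add_distrib]
  | tmul P Q =>
    simp only [mul₂_tmul, hom₂_tmul, hom_mul h, hom_mul h', TensorProduct.sum_tmul,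
      TensorProduct.tmul_sum, Algebra.TensorProduct.tmul_mul_tmul]
    rw [Finset.sum_comm]

variable [FiniteDimensional k A]

lemma hom₂_ext {X Y : Double k A ⊗[k] Double k A}
    (h : ∀ i j p q, hom₂ k A (cm k A i j) (cm k A p q) X = hom₂ k A (cm k A i j) (cm k A p q) Y) :
    X = Y := by
  let e : Double k A ≃ₗ[k] (A →ₗ[k] A) :=
    LinearEquiv.ofBijective (dualTensorHom k A A) (dualTensorHom_bijective (R := k))
  let E := (TensorProduct.congr e e).trans (homTensorHomEquiv k A A A A)
  have hE : ∀ Z t s, E Z (t ⊗ₜ s) = hom₂ k A t s Z := by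
    intro Z t s
    induction Z using TensorProduct.induction_on with
    | zero => simp
    | add P Q hP hQ => simp only [map_add, LinearMap.add_apply, hP, hQ]
    | tmul P Q => simp [E, e, hom₂_tmul]
  apply E.injective
  apply TensorProduct.ext
  refine ext_cm fun i j => ext_cm fun p q => ?_
  simp only [LinearMap.compr₂ₛₗ_apply, TensorProduct.mk_apply, hE, h]

lemma exists_dualComul (l : Dual k A) : ∃ S : Finset (Dual k A × Dual k A),
    dualComul k A l = ∑ i ∈ S, i.1 ⊗ₜ i.2 ∧ ∀ s t, l (s * t) = ∑ i ∈ S, i.1 t * i.2 s := by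
  obtain ⟨S, hS⟩ := TensorProduct.exists_finset (dualComul k A l)
  refine ⟨S, hS, fun s t => ?_⟩
  have h : TensorProduct.dualDistrib k A A (dualComul k A l) =
      (LinearMap.mul' k A ∘ₗ (TensorProduct.comm k A A).toLinearMap).dualMap l :=
    (TensorProduct.dualDistribEquiv k A A).apply_symm_apply _
  have h2 := LinearMap.congr_fun h (t ⊗ₜ s)
  rw [hS] at h2
  simpa using h2.symm

lemma lhit_mul_of_sum {l : Dual k A} {S : Finset (Dual k A × Dual k A)}
    (h : ∀ s t, l (s * t) = ∑ i ∈ S, i.1 t * i.2 s) (s t : A) :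
    lhit l (s * t) = ∑ i ∈ S, lhit i.2 s * lhit i.1 t := by
  induction s using cm_induction (k := k) (A := A) with
  | add a b ha hb => simp only [add_mul, map_add, ha, hb, Finset.sum_add_distrib]
  | smul c a ha => simp only [smul_mul_assoc, map_smul, ha, Finset.smul_sum]
  | zero => simp
  | mem i j =>
    induction t using cm_induction (k := k) (A := A) with
    | add a b ha hb => simp only [mul_add, map_add, ha, hb, Finset.sum_add_distrib]
    | smul c a ha => simp only [mul_smul_comm, map_smul, ha, Finset.smul_sum]
    | zero => simp
    | mem p q =>
      simp only [lhit, LinearMap.comp_apply, LinearEquiv.coe_coe, Bialgebra.comul_mul, comul_cm,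
        Finset.sum_mul_sum, Algebra.TensorProduct.tmul_mul_tmul, map_sum, LinearMap.rTensor_tmul,
        TensorProduct.lid_tmul, h, Finset.sum_smul, smul_mul_smul_comm]
      conv_rhs => rw [Finset.sum_comm]
      refine Finset.sum_congr rfl fun a _ => ?_
      rw [Finset.sum_comm]
      simp only [mul_comm]

lemma comul_tmul {l : Dual k A} {S : Finset (Dual k A × Dual k A)}
    (hS : dualComul k A l = ∑ i ∈ S, i.1 ⊗ₜ i.2) (i j : Fin (Module.finrank k A)) :
    comul k A (l ⊗ₜ cm k A i j) =
      ∑ m, ∑ e ∈ S, (e.1 ⊗ₜ cm k A i m) ⊗ₜ (e.2 ⊗ₜ cm k A m j) := by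
  simp [comul, hS, TensorProduct.sum_tmul, TensorProduct.tmul_sum]

/-- The reversed order `s * t` reflects the opposite comultiplication on the dual factor. -/
lemma hom₂_comul (t s : A) (P : Double k A) :
    hom₂ k A t s (comul k A P) = Coalgebra.comul (R := k) (dualTensorHom k A A P (s * t)) := by
  induction P using TensorProduct.induction_on with
  | zero => simp
  | add P Q hP hQ => simp only [map_add, LinearMap.add_apply, hP, hQ]
  | tmul l y =>
    induction y using cm_induction (k := k) (A := A) with
    | add a b ha hb => simp only [TensorProduct.tmul_add, map_add, LinearMap.add_apply, ha, hb]
    | smul c a ha => simp only [TensorProduct.tmul_smul, map_smul, LinearMap.smul_apply, ha]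
    | zero => simp
    | mem i j =>
      obtain ⟨S, hS, h⟩ := exists_dualComul l
      rw [comul_tmul hS]
      simp only [map_sum, hom₂_tmul, hom_tmul, h, Finset.sum_smul, map_smul, comul_cm,
        Finset.smul_sum, TensorProduct.tmul_smul, ← TensorProduct.smul_tmul', smul_smul]
      rw [Finset.sum_comm]
      simp only [mul_comm]

variable [hS : Fact (Function.Bijective (HopfAlgebra.antipode k : A →ₗ[k] A))]

/-- With six Sweedler legs of `cm k A i j`, the sum over `m` contains `y₄ S⁻¹(y₃)`, which contracts
to the counit; the surviving middle legs form a coproduct. -/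
lemma sum_comul_collapse {M : Type*} [AddCommGroup M] [Module k M] [Module (A ⊗[k] A) M]
    (Φ : A →ₗ[k] M) (s t : A) (i j : Fin (Module.finrank k A)) :
    ∑ m, ∑ a, ∑ b, ∑ c, ∑ d, (cm k A a b ⊗ₜ[k] cm k A c d) •
        Φ (antipodeInv k A (cm k A d j) * (s * cm k A m c) *
          (antipodeInv k A (cm k A b m) * (t * cm k A i a))) =
      ∑ a, ∑ d, Coalgebra.comul (R := k) (cm k A a d) •
        Φ (antipodeInv k A (cm k A d j) * (s * t * cm k A i a)) := by
  calc _ = ∑ a, ∑ b, ∑ c, ∑ d, (cm k A a b ⊗ₜ[k] cm k A c d) •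
        Φ (antipodeInv k A (cm k A d j) * (s * ((∑ m, cm k A m c *
          antipodeInv k A (cm k A b m)) * (t * cm k A i a)))) := by
        simp only [Finset.mul_sum, Finset.sum_mul, map_sum, Finset.smul_sum, mul_assoc]
        rw [Finset.sum_comm]
        refine Finset.sum_congr rfl fun a _ => ?_
        rw [Finset.sum_comm]
        refine Finset.sum_congr rfl fun b _ => ?_
        rw [Finset.sum_comm]
        refine Finset.sum_congr rfl fun c _ => ?_
        rw [Finset.sum_comm]
    _ = _ := by
        refine Finset.sum_congr rfl fun a _ => ?_
        simp only [sum_mul_antipodeInv_cm, comul_cm, Finset.sum_smul, mul_assoc, ite_mul, one_mul,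
          zero_mul, mul_ite, mul_zero, apply_ite Φ, map_zero, smul_ite, smul_zero,
          Finset.sum_ite_irrel, Finset.sum_const_zero, Finset.sum_ite_eq, Finset.mem_univ, if_true]
        rw [Finset.sum_comm]

lemma comul_mul (P Q : Double k A) :
    comul k A (mul P Q) = mul₂ (comul k A P) (comul k A Q) := by
  induction P using TensorProduct.induction_on with
  | zero => simp [zero_mul', zero_mul₂]
  | add P P' hP hP' => simp only [add_mul', map_add, add_mul₂, hP, hP']
  | tmul l y =>
    induction y using cm_induction (k := k) (A := A) with
    | add a b ha hb => simp only [TensorProduct.tmul_add, add_mul', map_add, add_mul₂, ha, hb]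
    | smul c a ha => simp only [TensorProduct.tmul_smul, smul_mul', map_smul, smul_mul₂, ha]
    | zero => simp [zero_mul', zero_mul₂]
    | mem i j =>
      obtain ⟨S, hS, h⟩ := exists_dualComul l
      refine hom₂_ext fun u u' w w' => ?_
      generalize cm k A u u' = t
      generalize cm k A w w' = s
      rw [hom₂_comul, hom_mul (comul₂_cm i j), comul_tmul hS]
      simp only [sum_mul₂, map_sum, hom₂_mul₂ (comul₂_cm _ _) (comul₂_cm _ _), hom₂_comul,
        lhit_mul_of_sum h, Fintype.sum_prod_type]
      have key := sum_comul_collapse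
        (Coalgebra.comul (R := k) ∘ₗ dualTensorHom k A A Q : A →ₗ[k] A ⊗[k] A)
      simp only [LinearMap.comp_apply, smul_eq_mul] at key
      conv_rhs => rw [Finset.sum_comm]
      simp only [key, Finset.sum_mul, Finset.mul_sum, map_sum, Bialgebra.comul_mul]
      conv_rhs => rw [Finset.sum_comm]
      refine Finset.sum_congr rfl fun a _ => ?_
      rw [Finset.sum_comm]

end

end Double

end QDouble

namespace QDouble

open Module (Dual)
open Coalgebra (counit)

namespace Double

/-! ### The R-matrix, `u` and the monodromy element -/

section

variable {k : Type*} [Field k] {A : Type*} [Ring A] [HopfAlgebra k A]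

lemma hom_ofAlg (y t : A) : dualTensorHom k A A (ofAlg k A y) t = counit (R := k) t • y := rfl

lemma hom_ofDual (l : Dual k A) (t : A) :
    dualTensorHom k A A (ofDual k A l) t = l t • (1 : A) := rfl

variable [FiniteDimensional k A]

lemma sum_ofVectorSpace (y : A) :
    ∑ i, (Module.Basis.ofVectorSpace k A).coord i y • Module.Basis.ofVectorSpace k A i = y := by
  simpa using (Module.Basis.ofVectorSpace k A).sum_repr y

lemma R_eq : R k A = ∑ i, ofAlg k A (Module.Basis.ofVectorSpace k A i) ⊗ₜ
    ofDual k A ((Module.Basis.ofVectorSpace k A).coord i) := by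
  rw [R, coevaluation_apply_one]
  simp

lemma hom_ofAlg_mul (i j : Fin (Module.finrank k A)) (Q : Double k A) (t : A) :
    dualTensorHom k A A (mul (ofAlg k A (cm k A i j)) Q) t = ∑ a, ∑ b, cm k A a b *
      dualTensorHom k A A Q (antipodeInv k A (cm k A b j) * (t * cm k A i a)) := by
  rw [ofAlg, TensorProduct.mk_apply, hom_mul (comul₂_cm i j), dualOne]
  simp only [lhit_counit, Fintype.sum_prod_type]

lemma comm_mul₂ (P Q : Double k A ⊗[k] Double k A) :
    TensorProduct.comm k _ _ (mul₂ P Q) =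
      mul₂ (TensorProduct.comm k _ _ P) (TensorProduct.comm k _ _ Q) := by
  induction P using TensorProduct.induction_on with
  | zero => simp only [zero_mul₂, map_zero]
  | add P P' hP hP' => simp only [add_mul₂, map_add, hP, hP']
  | tmul a b =>
    induction Q using TensorProduct.induction_on with
    | zero => simp only [mul₂_zero, map_zero]
    | add P P' hP hP' => simp only [mul₂_add, map_add, hP, hP']
    | tmul c d => simp only [mul₂_tmul, TensorProduct.comm_tmul]

lemma hom₂_comm (t s : A) (X : Double k A ⊗[k] Double k A) :
    hom₂ k A t s (TensorProduct.comm k _ _ X) = TensorProduct.comm k _ _ (hom₂ k A s t X) := by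
  induction X using TensorProduct.induction_on with
  | zero => simp only [map_zero]
  | add P P' hP hP' => simp only [map_add, hP, hP']
  | tmul a b => simp only [TensorProduct.comm_tmul, hom₂_tmul]

variable [hS : Fact (Function.Bijective (HopfAlgebra.antipode k : A →ₗ[k] A))]

lemma hom_ofAlg_groupLike_mul {g : A} (hg : Coalgebra.comul (R := k) g = g ⊗ₜ g) (l : Dual k A)
    (Q : Double k A) (t : A) : dualTensorHom k A A (mul (l ⊗ₜ g) Q) t =
      g * dualTensorHom k A A Q (antipodeInv k A g * (lhit l t * g)) := by
  have h : comul₂ k A g = ∑ _a : Unit, g ⊗ₜ[k] (g ⊗ₜ[k] g) := by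
    simp [comul₂, hg]
  rw [hom_mul h]
  simp

lemma hom_ofDual_mul (l : Dual k A) (Q : Double k A) (t : A) :
    dualTensorHom k A A (mul (ofDual k A l) Q) t = dualTensorHom k A A Q (lhit l t) := by
  rw [ofDual, LinearMap.flip_apply, TensorProduct.mk_apply, hom_mul comul₂_one]
  simp

lemma ofDual_mul_ofAlg (l : Dual k A) (y : A) : mul (ofDual k A l) (ofAlg k A y) = l ⊗ₜ y := by
  refine hom_ext fun t => ?_
  rw [hom_ofDual_mul, hom_ofAlg, counit_lhit, hom_tmul]

lemma hom_mul_ofAlg (P : Double k A) (y t : A) :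
    dualTensorHom k A A (mul P (ofAlg k A y)) t = dualTensorHom k A A P t * y := by
  induction P using TensorProduct.induction_on with
  | zero => simp [zero_mul']
  | add P Q hP hQ => simp only [add_mul', map_add, LinearMap.add_apply, hP, hQ, add_mul]
  | tmul l z =>
    induction z using cm_induction (k := k) (A := A) with
    | add a b ha hb =>
      simp only [TensorProduct.tmul_add, add_mul', map_add, LinearMap.add_apply, ha, hb, add_mul]
    | smul c a ha =>
      simp only [TensorProduct.tmul_smul, smul_mul', map_smul, LinearMap.smul_apply, ha,
        smul_mul_assoc]
    | zero => simp [zero_mul']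
    | mem i j =>
      have h1 := congrArg (fun P => dualTensorHom k A A P t) (mul_one' (l ⊗ₜ[k] cm k A i j))
      simp only [hom_mul (comul₂_cm i j), one, dualOne, hom_tmul] at h1
      rw [hom_mul (comul₂_cm i j), hom_tmul, ← h1]
      simp only [hom_ofAlg, Finset.sum_mul, mul_smul_comm, smul_mul_assoc, mul_one]

/-- In Sweedler form, `(P Q)(t) = (P(t₁) · Q)(t₂)` with `P(t₁)` taken in `A`. This follows by
writing `l ⊗ z` as `l · z` and lets any left factor be treated through its values. -/
lemma hom_mul_cm (P Q : Double k A) (p q : Fin (Module.finrank k A)) :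
    dualTensorHom k A A (mul P Q) (cm k A p q) = ∑ r,
      dualTensorHom k A A (mul (ofAlg k A (dualTensorHom k A A P (cm k A p r))) Q)
        (cm k A r q) := by
  induction P using TensorProduct.induction_on with
  | zero => simp [zero_mul']
  | add P P' hP hP' =>
    simp only [add_mul', map_add, LinearMap.add_apply, hP, hP', Finset.sum_add_distrib]
  | tmul l z =>
    rw [← ofDual_mul_ofAlg, mul_assoc', hom_ofDual_mul, lhit_cm]
    simp only [map_sum, map_smul, ofDual_mul_ofAlg, hom_tmul, smul_mul', LinearMap.smul_apply]

lemma antipode_ofDual (l : Dual k A) :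
    antipode k A (ofDual k A l) = ofDual k A (l ∘ₗ antipodeInv k A) := by
  simp [ofDual, antipode, bicross, comul₂, Algebra.TensorProduct.one_def, dualAntipode]
  congr 1
  ext t
  simp

/-- The dual-basis sum is `∑ f_i(S⁻¹ t) e_i = S⁻¹(t)`. -/
lemma hom_u (t : A) : dualTensorHom k A A (u k A) t = antipodeInv k A t := by
  have : u k A = ∑ i, mul (ofDual k A ((Module.Basis.ofVectorSpace k A).coord i ∘ₗ
      antipodeInv k A)) (ofAlg k A (Module.Basis.ofVectorSpace k A i)) := by
    rw [u, R_eq]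
    simp [antipode_ofDual, mul]
  rw [this, map_sum, LinearMap.sum_apply]
  simp only [hom_ofDual_mul, hom_ofAlg, counit_lhit, LinearMap.comp_apply]
  exact sum_ofVectorSpace _

lemma hom_u_mul (Q : Double k A) (p q : Fin (Module.finrank k A)) :
    dualTensorHom k A A (mul (u k A) Q) (cm k A p q) = ∑ a, antipodeInv k A (cm k A a q) *
      dualTensorHom k A A Q (antipodeInv k A (antipodeInv k A (cm k A p a))) := by
  have h : ∀ r, comul₂ k A (antipodeInv k A (cm k A p r)) =
      ∑ a : Fin (Module.finrank k A) × Fin (Module.finrank k A), antipodeInv k A (cm k A a.2 r) ⊗ₜ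
        (antipodeInv k A (cm k A a.1 a.2) ⊗ₜ antipodeInv k A (cm k A p a.1)) := by
    intro r
    simp only [comul₂, LinearMap.comp_apply, comul_antipodeInv_cm, map_sum, LinearMap.lTensor_tmul,
      TensorProduct.tmul_sum, Fintype.sum_prod_type_right]
  rw [hom_mul_cm]
  simp only [hom_u, ofAlg, TensorProduct.mk_apply, hom_mul (h _), dualOne, lhit_counit]
  rw [Finset.sum_comm]
  simp only [← Finset.mul_sum, ← map_sum, sum_mul_antipodeInv_cm, Fintype.sum_prod_type]
  simp [apply_ite (dualTensorHom k A A Q)]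

lemma hom₂_R_mul (t : A) (p q : Fin (Module.finrank k A)) (X : Double k A ⊗[k] Double k A) :
    hom₂ k A t (cm k A p q) (mul₂ (R k A) X) = ∑ r, ∑ a, ∑ b, (cm k A a b ⊗ₜ 1) *
      hom₂ k A (antipodeInv k A (cm k A b r) * (t * cm k A p a)) (cm k A r q) X := by
  have h1 : ∀ (i j : Fin (Module.finrank k A)) (l : Dual k A) s, hom₂ k A t s
      (mul₂ (ofAlg k A (cm k A i j) ⊗ₜ ofDual k A l) X) = ∑ a, ∑ b, (cm k A a b ⊗ₜ 1) *
        hom₂ k A (antipodeInv k A (cm k A b j) * (t * cm k A i a)) (lhit l s) X := by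
    intro i j l s
    rw [ofDual, LinearMap.flip_apply, ofAlg, TensorProduct.mk_apply, TensorProduct.mk_apply,
      hom₂_mul₂ (comul₂_cm i j) comul₂_one, dualOne]
    simp [Fintype.sum_prod_type]
  have h2 : ∀ (y : A) (l : Dual k A), hom₂ k A t (cm k A p q)
      (mul₂ (ofAlg k A y ⊗ₜ ofDual k A l) X) = ∑ r, hom₂ k A t (cm k A r q)
        (mul₂ (ofAlg k A (l (cm k A p r) • y) ⊗ₜ one k A) X) := by
    intro y l
    induction y using cm_induction (k := k) (A := A) with
    | add a b ha hb =>
      simp only [map_add, TensorProduct.add_tmul, add_mul₂, smul_add, ha, hb,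
        Finset.sum_add_distrib]
    | smul c a ha =>
      simp only [map_smul, smul_comm _ c, ← TensorProduct.smul_tmul', smul_mul₂, ha,
        Finset.smul_sum]
    | zero => simp [zero_mul₂]
    | mem i j =>
      have : one k A = ofDual k A counit := rfl
      simp only [map_smul, ← TensorProduct.smul_tmul', smul_mul₂, this, h1, lhit_counit,
        lhit_cm l p q, map_sum, LinearMap.sum_apply, LinearMap.smul_apply, Finset.mul_sum,
        Finset.smul_sum, mul_smul_comm]
      conv_rhs => rw [Finset.sum_comm]
      refine Finset.sum_congr rfl fun a _ => ?_
      rw [Finset.sum_comm]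
  have h3 : one k A = ofDual k A counit := rfl
  rw [R_eq, sum_mul₂, map_sum]
  simp only [h2]
  rw [Finset.sum_comm]
  simp only [← map_sum, ← sum_mul₂, ← TensorProduct.sum_tmul, sum_ofVectorSpace]
  simp only [h3, h1, lhit_counit]

lemma hom₂_R_comul_u (t s : A) : hom₂ k A t s (mul₂ (R k A) (comul k A (u k A))) =
    (1 ⊗ₜ antipodeInv k A s) * Coalgebra.comul (R := k) (antipodeInv k A t) := by
  induction s using cm_induction (k := k) (A := A) with
  | add a b ha hb => simp only [map_add, LinearMap.add_apply, TensorProduct.tmul_add, ha, hb,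
      add_mul]
  | smul c a ha => simp only [map_smul, LinearMap.smul_apply, TensorProduct.tmul_smul, ha,
      smul_mul_assoc]
  | zero => simp
  | mem p q =>
    rw [hom₂_R_mul]
    simp only [hom₂_comul, hom_u]
    calc _ = ∑ a, ∑ b, (cm k A a b ⊗ₜ[k] (1 : A)) * Coalgebra.comul (R := k) (antipodeInv k A
          ((∑ r, cm k A r q * antipodeInv k A (cm k A b r)) * (t * cm k A p a))) := by
          simp only [Finset.sum_mul, Finset.mul_sum, map_sum, mul_assoc]
          rw [Finset.sum_comm]
          refine Finset.sum_congr rfl fun a _ => ?_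
          rw [Finset.sum_comm]
      _ = ∑ b, ((∑ a, cm k A a q * antipodeInv k A (cm k A b a)) ⊗ₜ[k]
          antipodeInv k A (cm k A p b)) * Coalgebra.comul (R := k) (antipodeInv k A t) := by
          simp only [sum_mul_antipodeInv_cm, ite_mul, one_mul, zero_mul, apply_ite (antipodeInv k A),
            apply_ite (Coalgebra.comul (R := k) (A := A)), map_zero, mul_ite, mul_zero,
            Finset.sum_ite_eq', Finset.mem_univ, if_true, antipodeInv_mul,
            Bialgebra.comul_mul, comul_antipodeInv_cm, ← mul_assoc, Finset.mul_sum,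
            Algebra.TensorProduct.tmul_mul_tmul, Finset.sum_mul]
          rw [Finset.sum_comm]
          simp only [← Finset.sum_mul, ← TensorProduct.sum_tmul, sum_mul_antipodeInv_cm]
      _ = _ := by
          simp only [sum_mul_antipodeInv_cm, TensorProduct.ite_tmul, ite_mul, zero_mul,
            Finset.sum_ite_eq', Finset.mem_univ, if_true]

lemma hom₂_comm_R_mul (s : A) (p q : Fin (Module.finrank k A))
    (X : Double k A ⊗[k] Double k A) :
    hom₂ k A (cm k A p q) s (mul₂ (TensorProduct.comm k _ _ (R k A)) X) =
      ∑ r, ∑ a, ∑ b, (1 ⊗ₜ cm k A a b) *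
        hom₂ k A (cm k A r q) (antipodeInv k A (cm k A b r) * (s * cm k A p a)) X := by
  have hc : ∀ y z : A ⊗[k] A, TensorProduct.comm k A A (y * z) =
      TensorProduct.comm k A A y * TensorProduct.comm k A A z :=
    map_mul (Algebra.TensorProduct.comm k A A)
  have hX : X = TensorProduct.comm k _ _ (TensorProduct.comm k _ _ X) := by
    simp only [TensorProduct.comm_comm]
  rw [hX, ← comm_mul₂, hom₂_comm, hom₂_R_mul]
  simp only [map_sum, hc, hom₂_comm, TensorProduct.comm_comm, TensorProduct.comm_tmul]

/-- Apply the two factors of `M` in turn. Evaluated at `(t, s)`, `R Δ(u)` is `(1 ⊗ S⁻¹ s) Δ(S⁻¹ t)`;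
multiplying by the flipped `R` then contracts twice through `∑ y₂ S⁻¹(y₁) = ε(y)`, leaving `S⁻¹ ⊗
S⁻¹`. -/
lemma M_mul_comul_u : mul₂ (M k A) (comul k A (u k A)) = u k A ⊗ₜ u k A := by
  refine hom₂_ext fun p q i j => ?_
  rw [M, mul₂_assoc, hom₂_comm_R_mul]
  simp only [hom₂_R_comul_u, hom₂_tmul, hom_u]
  generalize cm k A i j = s
  calc _ = ∑ r, ∑ b, ((1 : A) ⊗ₜ[k] ((∑ a, cm k A a b * antipodeInv k A (cm k A p a)) *
        (antipodeInv k A s * antipodeInv k A (antipodeInv k A (cm k A b r))))) *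
          Coalgebra.comul (R := k) (antipodeInv k A (cm k A r q)) := by
        simp only [antipodeInv_mul, ← mul_assoc, Algebra.TensorProduct.tmul_mul_tmul, one_mul,
          Finset.sum_mul, TensorProduct.tmul_sum]
        refine Finset.sum_congr rfl fun r _ => ?_
        rw [Finset.sum_comm]
    _ = ∑ r, ((1 : A) ⊗ₜ[k] (antipodeInv k A s * antipodeInv k A (antipodeInv k A (cm k A p r)))) *
          Coalgebra.comul (R := k) (antipodeInv k A (cm k A r q)) := by
        simp only [sum_mul_antipodeInv_cm, ite_mul, one_mul, zero_mul, TensorProduct.tmul_ite,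
          Finset.sum_ite_eq, Finset.mem_univ, if_true]
    _ = ∑ c, antipodeInv k A (cm k A c q) ⊗ₜ[k] (antipodeInv k A s *
          antipodeInv k A (∑ r, cm k A r c * antipodeInv k A (cm k A p r))) := by
        simp only [comul_antipodeInv_cm, Finset.mul_sum, map_sum, TensorProduct.tmul_sum,
          Algebra.TensorProduct.tmul_mul_tmul, antipodeInv_mul, mul_assoc, one_mul]
        rw [Finset.sum_comm]
    _ = _ := by
        simp only [sum_mul_antipodeInv_cm]
        simp [apply_ite (antipodeInv k A), TensorProduct.tmul_ite]

end

end Double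

end QDouble

namespace QDouble

open Module (Dual)
open Coalgebra (counit)

/-! ### Group-like elements of `A` -/

section GroupLike

variable {k : Type*} [Field k] {A : Type*} [Ring A] [HopfAlgebra k A] {g : A}

lemma groupLike_mul_antipode (hg : Coalgebra.comul (R := k) g = g ⊗ₜ g)
    (hε : counit (R := k) g = 1) : g * HopfAlgebra.antipode k g = 1 := by
  have := HopfAlgebra.mul_antipode_lTensor_comul_apply (R := k) g
  simpa [hg, hε] using this

lemma antipode_mul_groupLike (hg : Coalgebra.comul (R := k) g = g ⊗ₜ g)
    (hε : counit (R := k) g = 1) : HopfAlgebra.antipode k g * g = 1 := by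
  have := HopfAlgebra.mul_antipode_rTensor_comul_apply (R := k) g
  simpa [hg, hε] using this

lemma antipode_antipode_groupLike (hg : Coalgebra.comul (R := k) g = g ⊗ₜ g)
    (hε : counit (R := k) g = 1) :
    HopfAlgebra.antipode k (HopfAlgebra.antipode k g) = g := by
  have h := congrArg (HopfAlgebra.antipode k) (groupLike_mul_antipode hg hε)
  rw [HopfAlgebra.antipode_mul_antidistrib, HopfAlgebra.antipode_one] at h
  exact left_inv_eq_right_inv h (antipode_mul_groupLike hg hε)

lemma antipodeInv_groupLike [hS : Fact (Function.Bijective (HopfAlgebra.antipode k : A →ₗ[k] A))]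
    (hg : Coalgebra.comul (R := k) g = g ⊗ₜ g) (hε : counit (R := k) g = 1) :
    antipodeInv k A g = HopfAlgebra.antipode k g := by
  conv_lhs => rw [← antipode_antipode_groupLike hg hε]
  simp

lemma comul_antipode_groupLike [FiniteDimensional k A]
    (hg : Coalgebra.comul (R := k) g = g ⊗ₜ g) :
    Coalgebra.comul (R := k) (HopfAlgebra.antipode k g) =
      HopfAlgebra.antipode k g ⊗ₜ HopfAlgebra.antipode k g := by
  simp [comul_antipode, hg]

lemma map_antipode_groupLike (hg : Coalgebra.comul (R := k) g = g ⊗ₜ g)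
    (hε : counit (R := k) g = 1) (β : A →ₐ[k] k) :
    β (HopfAlgebra.antipode k g) = (β g)⁻¹ := by
  refine eq_inv_of_mul_eq_one_left ?_
  rw [← map_mul, antipode_mul_groupLike hg hε, map_one]

lemma map_groupLike_ne_zero (hg : Coalgebra.comul (R := k) g = g ⊗ₜ g)
    (hε : counit (R := k) g = 1) (β : A →ₐ[k] k) : β g ≠ 0 := by
  refine left_ne_zero_of_mul_eq_one (b := β (HopfAlgebra.antipode k g)) ?_
  rw [← map_mul, groupLike_mul_antipode hg hε, map_one]

end GroupLike

namespace Double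

/-! ### The balancing, explicit forms of `v` and `v⁻¹`, and the square of the antipode -/

section

variable {k : Type*} [Field k] {A : Type*} [Ring A] [HopfAlgebra k A] [FiniteDimensional k A]
  [hS : Fact (Function.Bijective (HopfAlgebra.antipode k : A →ₗ[k] A))] {v w : Double k A}

lemma one_mul₂ (X : Double k A ⊗[k] Double k A) : mul₂ (one k A ⊗ₜ one k A) X = X := by
  induction X using TensorProduct.induction_on with
  | zero => simp only [mul₂_zero]
  | add P P' hP hP' => simp only [mul₂_add, hP, hP']
  | tmul c d => simp only [mul₂_tmul, one_mul']

lemma IsRibbonElement.comul_balancing (hv : IsRibbonElement v w) :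
    comul k A (mul w (u k A)) = mul w (u k A) ⊗ₜ mul w (u k A) := by
  have h : comul k A w = mul₂ (w ⊗ₜ w) (M k A) := by
    rw [hv.monodromy, ← mul₂_assoc, mul₂_tmul, hv.inv_mul, one_mul₂]
  rw [comul_mul, h, mul₂_assoc, M_mul_comul_u, mul₂_tmul]

/-- As a map `B`, group-likeness of `b` reads `Δ(B(s t)) = B(t) ⊗ B(s)`. At `s = 1` the counit shows
that `B` has rank one with image spanned by `g = B(1)`; two counits show that `β = ε ∘ B` is
multiplicative. -/
lemma IsRibbonElement.exists_groupLike (hv : IsRibbonElement v w) :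
    ∃ (β : A →ₐ[k] k) (g : A), Coalgebra.comul (R := k) g = g ⊗ₜ g ∧ counit (R := k) g = 1 ∧
      mul w (u k A) = β.toLinearMap ⊗ₜ g := by
  set b := mul w (u k A) with hb
  set B := dualTensorHom k A A b with hB
  have key : ∀ s t, Coalgebra.comul (R := k) (B (s * t)) = B t ⊗ₜ B s := by
    intro s t
    rw [← hom₂_comul, hv.comul_balancing, hom₂_tmul]
  have hBt : ∀ t, B t = counit (R := k) (B t) • B 1 := by
    intro t
    have h1 := key 1 t
    rw [one_mul] at h1
    have h2 := Coalgebra.rTensor_counit_comul (R := k) (B t)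
    rw [h1] at h2
    simpa using (congrArg (TensorProduct.lid k A) h2).symm
  have hmul : ∀ s t, counit (R := k) (B (s * t)) = counit (R := k) (B s) * counit (R := k) (B t) := by
    intro s t
    have h1 := key s t
    have h2 := Coalgebra.rTensor_counit_comul (R := k) (B (s * t))
    rw [h1] at h2
    have h3 := congrArg (fun z => counit (R := k) (TensorProduct.lid k A z)) h2
    simpa [mul_comm] using h3.symm
  -- This scalar is idempotent. Were it zero, `b` and hence `u = v b` would vanish, but `u` takes
  -- `1` to `1`.
  have hone : counit (R := k) (B 1) = 1 := by
    have h1 := hmul 1 1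
    rw [mul_one] at h1
    by_contra hne
    have h0 : counit (R := k) (B 1) = 0 := by
      by_contra h0
      exact hne (mul_left_cancel₀ h0 (by rw [← h1, mul_one]))
    have hB1 : B 1 = 0 := by rw [hBt 1, h0, zero_smul]
    have hb0 : b = 0 := hom_ext fun t => by
      change B t = _
      rw [hBt t, hB1]; simp
    have hu : u k A = 0 := by
      rw [← one_mul' (u k A), ← hv.mul_inv, mul_assoc', ← hb, hb0, mul_zero']
    have h2 := hom_u (k := k) (A := A) 1
    rw [hu] at h2
    have h3 := congrArg (counit (R := k)) h2
    simp at h3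
  refine ⟨AlgHom.ofLinearMap (counit ∘ₗ B) hone hmul, B 1, ?_, hone, ?_⟩
  · simpa using key 1 1
  · exact hom_ext fun t => hBt t

variable {β : A →ₐ[k] k} {g : A}

lemma hom_w (hg : Coalgebra.comul (R := k) g = g ⊗ₜ g)
    (hε : counit (R := k) g = 1) (hb : mul w (u k A) = β.toLinearMap ⊗ₜ g) (t : A) :
    dualTensorHom k A A w t =
      HopfAlgebra.antipode k (HopfAlgebra.antipode k (lhit β.toLinearMap t)) * g := by
  -- The element representing `S²` is a right inverse of `u`, which suffices to solve `w u = β ⊗ g`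
  -- for `w`.
  obtain ⟨z, hz⟩ := (dualTensorHom_bijective (R := k) (M := A) (N := A)).2
    (HopfAlgebra.antipode k ∘ₗ HopfAlgebra.antipode k)
  have huz : mul (u k A) z = one k A := by
    refine (dualTensorHom_bijective (R := k) (M := A) (N := A)).1 (ext_cm fun p q => ?_)
    rw [hom_u_mul, hz, one, hom_tmul, dualOne]
    simp [sum_antipodeInv_mul_cm]
  have hw : w = mul (β.toLinearMap ⊗ₜ g) z := by
    rw [← hb, mul_assoc', huz, mul_one']
  rw [hw, hom_ofAlg_groupLike_mul hg, hz, antipodeInv_groupLike hg hε]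
  simp only [LinearMap.comp_apply, HopfAlgebra.antipode_mul_antidistrib,
    antipode_antipode_groupLike hg hε]
  rw [← mul_assoc, ← mul_assoc, groupLike_mul_antipode hg hε, one_mul]

lemma hom_v (hv : IsRibbonElement v w) (hg : Coalgebra.comul (R := k) g = g ⊗ₜ g)
    (hε : counit (R := k) g = 1) (hb : mul w (u k A) = β.toLinearMap ⊗ₜ g) (t : A) :
    dualTensorHom k A A v t =
      antipodeInv k A (lhit (charInv β).toLinearMap t) * HopfAlgebra.antipode k g := by
  have hbi : mul (β.toLinearMap ⊗ₜ g) ((charInv β).toLinearMap ⊗ₜ HopfAlgebra.antipode k g) =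
      one k A := by
    refine hom_ext fun t => ?_
    rw [hom_ofAlg_groupLike_mul hg, hom_tmul, antipodeInv_groupLike hg hε, one, hom_tmul, dualOne]
    have h1 : charInv β (HopfAlgebra.antipode k g) * charInv β g = 1 := by
      rw [← map_mul, antipode_mul_groupLike hg hε, map_one]
    have h2 : charInv β (lhit β.toLinearMap t) = counit (R := k) t := by
      have := counit_lhit (charInv β).toLinearMap (lhit β.toLinearMap t)
      rw [lhit_charInv_lhit] at this
      exact this.symm
    simp only [AlgHom.toLinearMap_apply, map_mul, mul_smul_comm, groupLike_mul_antipode hg hε, h2]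
    rw [mul_left_comm, h1, mul_one]
  have hv2 : v = mul (u k A) ((charInv β).toLinearMap ⊗ₜ HopfAlgebra.antipode k g) := by
    have h1 : mul v (β.toLinearMap ⊗ₜ g) = u k A := by
      rw [← hb, ← mul_assoc', hv.mul_inv, one_mul']
    rw [← h1, mul_assoc', hbi, mul_one']
  rw [hv2]
  refine LinearMap.congr_fun (g := LinearMap.mulRight k (HopfAlgebra.antipode k g) ∘ₗ
    antipodeInv k A ∘ₗ lhit (charInv β).toLinearMap) (ext_cm fun p q => ?_) t
  rw [hom_u_mul]
  simp only [hom_tmul, AlgHom.toLinearMap_apply, apply_antipodeInv, charInv_charInv,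
    LinearMap.comp_apply, lhit_cm, map_sum, map_smul, LinearMap.mulRight_apply, mul_smul_comm]

lemma ofAlg_mul_u (y : A) : mul (ofAlg k A y) (u k A) =
    mul (u k A) (ofAlg k A (antipodeInv k A (antipodeInv k A y))) := by
  refine hom_ext fun t => ?_
  induction y using cm_induction (k := k) (A := A) with
  | add a b ha hb =>
    simp only [map_add, add_mul', mul_add', LinearMap.add_apply, ha, hb]
  | smul c a ha => simp only [map_smul, smul_mul', mul_smul', LinearMap.smul_apply, ha]
  | zero => simp [zero_mul', mul_zero']
  | mem i j =>
    rw [hom_mul_ofAlg, hom_ofAlg_mul, hom_u]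
    simp only [hom_u, antipodeInv_mul, ← mul_assoc]
    rw [Finset.sum_comm]
    simp only [← Finset.sum_mul, sum_mul_antipodeInv_cm]
    simp

lemma hom_ofAlg_mul_char (y : A) :
    dualTensorHom k A A (mul (ofAlg k A y) (β.toLinearMap ⊗ₜ g)) 1 =
      lhit β.toLinearMap (rhit (charInv β).toLinearMap y) * g := by
  induction y using cm_induction (k := k) (A := A) with
  | add a b ha hb => simp only [map_add, add_mul', LinearMap.add_apply, ha, hb, add_mul]
  | smul c a ha =>
    simp only [map_smul, smul_mul', LinearMap.smul_apply, ha, smul_mul_assoc]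
  | zero => simp [zero_mul']
  | mem i j =>
    rw [hom_ofAlg_mul]
    simp only [hom_tmul, AlgHom.toLinearMap_apply, map_mul, one_mul, apply_antipodeInv,
      rhit_cm, lhit_cm, map_sum, map_smul, Finset.sum_mul, smul_mul_assoc, mul_smul_comm,
      Finset.smul_sum, smul_smul]
    rw [Finset.sum_comm]

/-- Centrality of `w` and `y u = u S⁻²(y)` give `y b = b S⁻²(y)` in the double; evaluating both
sides at `1` gives the relation in `A`. -/
lemma groupLike_mul_antipodeInv (hv : IsRibbonElement v w)
    (hb : mul w (u k A) = β.toLinearMap ⊗ₜ g) (y : A) :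
    g * antipodeInv k A (antipodeInv k A y) =
      lhit β.toLinearMap (rhit (charInv β).toLinearMap y) * g := by
  have hw : ∀ P, mul P w = mul w P := fun P => by
    rw [← one_mul' (mul P w), ← hv.inv_mul, mul_assoc', ← mul_assoc' v, hv.central, mul_assoc',
      hv.mul_inv, mul_one']
  have h1 : mul (ofAlg k A y) (β.toLinearMap ⊗ₜ g) =
      mul (β.toLinearMap ⊗ₜ g) (ofAlg k A (antipodeInv k A (antipodeInv k A y))) := by
    rw [← hb, ← mul_assoc', hw, mul_assoc', ofAlg_mul_u, mul_assoc']
  have h2 := congrArg (fun P => dualTensorHom k A A P 1) h1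
  simp only [hom_mul_ofAlg, hom_tmul, AlgHom.toLinearMap_apply, map_one, one_smul] at h2
  rw [← h2, hom_ofAlg_mul_char]

/-- Solve `groupLike_mul_antipodeInv` for `S²(y)`. Undoing the hits also rescales the two copies of
`g`, and those scalars cancel. -/
lemma antipode_antipode_eq (hv : IsRibbonElement v w)
    (hg : Coalgebra.comul (R := k) g = g ⊗ₜ g)
    (hε : counit (R := k) g = 1) (hb : mul w (u k A) = β.toLinearMap ⊗ₜ g) (y : A) :
    HopfAlgebra.antipode k (HopfAlgebra.antipode k y) =
      g * lhit (charInv β).toLinearMap (rhit β.toLinearMap y) * HopfAlgebra.antipode k g := by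
  have h1 := groupLike_mul_antipodeInv hv hb
    (HopfAlgebra.antipode k (HopfAlgebra.antipode k y))
  simp only [antipodeInv_antipode] at h1
  have h2 : lhit β.toLinearMap (rhit (charInv β).toLinearMap
      (HopfAlgebra.antipode k (HopfAlgebra.antipode k y))) = g * y * HopfAlgebra.antipode k g := by
    rw [h1, mul_assoc, groupLike_mul_antipode hg hε, mul_one]
  have h3 := congrArg (fun z => rhit β.toLinearMap (lhit (charInv β).toLinearMap z)) h2
  simp only [lhit_charInv_lhit, rhit_rhit_charInv] at h3
  have hβ := map_groupLike_ne_zero hg hε β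
  have hgi := comul_antipode_groupLike (k := k) hg
  rw [h3, lhit_mul, lhit_mul, rhit_mul, rhit_mul, lhit_groupLike _ hg, lhit_groupLike _ hgi,
    ← lhit_rhit_comm]
  simp only [map_smul, rhit_groupLike _ hg, rhit_groupLike _ hgi, AlgHom.toLinearMap_apply,
    charInv_apply, map_antipode_groupLike hg hε,
    smul_mul_assoc, mul_smul_comm, smul_smul]
  rw [show (β g)⁻¹⁻¹ * (β g)⁻¹ * ((β g)⁻¹ * β g) = 1 by field_simp, one_smul]

end

end Double

end QDouble

namespace QDouble

open Module (Dual)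
open Coalgebra (counit)

namespace Double

/-! ### The antipode of D(A) and the integral `μ_D` -/

section

variable {k : Type*} [Field k] {A : Type*} [Ring A] [HopfAlgebra k A]

lemma integral_apply (μ : Dual k A) (x : A) (P : Double k A) :
    integral μ x P = μ (HopfAlgebra.antipode k (dualTensorHom k A A P x)) := by
  induction P using TensorProduct.induction_on with
  | zero => simp
  | add P Q hP hQ => simp only [map_add, LinearMap.add_apply, hP, hQ]
  | tmul l y => simp [integral]

variable [FiniteDimensional k A]
  [hS : Fact (Function.Bijective (HopfAlgebra.antipode k : A →ₗ[k] A))] {v w : Double k A}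

lemma antipode_tmul (l : Dual k A) (y : A) : antipode k A (l ⊗ₜ y) =
    mul (ofAlg k A (HopfAlgebra.antipode k y)) (ofDual k A (l ∘ₗ antipodeInv k A)) := by
  have h : ∀ (z : A) (m : Dual k A), bicross k A (z ⊗ₜ m) = mul (ofAlg k A z) (ofDual k A m) := by
    intro z m
    induction z using cm_induction (k := k) (A := A) with
    | add a b ha hb => simp only [map_add, add_mul', TensorProduct.add_tmul, ha, hb]
    | smul c a ha => simp only [map_smul, smul_mul', ← TensorProduct.smul_tmul', ha]
    | zero => simp [zero_mul']
    | mem i j =>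
      rw [ofAlg, ofDual, LinearMap.flip_apply, TensorProduct.mk_apply, TensorProduct.mk_apply,
        mul_tmul_tmul (comul₂_cm i j)]
      simp only [bicross, TensorProduct.lift.tmul, LinearMap.mk₂_apply, comul₂_cm, map_sum,
        bicrossAux_tmul, mul_one]
      refine Finset.sum_congr rfl fun a _ => ?_
      congr 1
      ext t
      simp [dualMul_apply_left, dualOne]
  rw [← h]
  rfl

lemma comul₂_antipode_cm (i j : Fin (Module.finrank k A)) :
    comul₂ k A (HopfAlgebra.antipode k (cm k A i j)) =
      ∑ a : Fin (Module.finrank k A) × Fin (Module.finrank k A),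
        HopfAlgebra.antipode k (cm k A a.2 j) ⊗ₜ (HopfAlgebra.antipode k (cm k A a.1 a.2) ⊗ₜ
          HopfAlgebra.antipode k (cm k A i a.1)) := by
  simp only [comul₂, LinearMap.comp_apply, comul_antipode_cm, map_sum, LinearMap.lTensor_tmul,
    TensorProduct.tmul_sum, Fintype.sum_prod_type_right]

lemma hom_antipode_tmul_cm (l : Dual k A) (i j : Fin (Module.finrank k A)) (t : A) :
    dualTensorHom k A A (antipode k A (l ⊗ₜ cm k A i j)) t = ∑ c, ∑ d,
      l (antipodeInv k A (cm k A i c * (t * HopfAlgebra.antipode k (cm k A d j)))) •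
        HopfAlgebra.antipode k (cm k A c d) := by
  rw [antipode_tmul, ofAlg, TensorProduct.mk_apply, hom_mul (comul₂_antipode_cm i j)]
  simp only [dualOne, lhit_counit, antipodeInv_antipode, hom_ofDual, LinearMap.comp_apply,
    mul_smul_comm, mul_one, Fintype.sum_prod_type]

/-- The instance of antimultiplicativity of the antipode that 𝒮 requires. The conjugations from the
bicrossing and from the antipode cancel leg by leg. -/
lemma antipode_ofAlg_mul_ofDual (y : A) (l : Dual k A) :
    antipode k A (mul (ofAlg k A y) (ofDual k A l)) =
      (l ∘ₗ antipodeInv k A) ⊗ₜ HopfAlgebra.antipode k y := by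
  induction y using cm_induction (k := k) (A := A) with
  | add a b ha hb => simp only [map_add, add_mul', TensorProduct.tmul_add, ha, hb]
  | smul c a ha => simp only [map_smul, smul_mul', TensorProduct.tmul_smul, ha]
  | zero => simp [zero_mul']
  | mem i j =>
    refine hom_ext fun t => ?_
    rw [ofAlg, ofDual, LinearMap.flip_apply, TensorProduct.mk_apply, TensorProduct.mk_apply,
      mul_tmul_tmul (comul₂_cm i j), map_sum, map_sum, LinearMap.sum_apply]
    simp only [mul_one, hom_antipode_tmul_cm, hom_tmul, dualOne, dualMul_apply_left, lhit_counit,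
      sandwich_apply, Fintype.sum_prod_type, antipodeInv_mul, antipodeInv_antipode,
      LinearMap.comp_apply]
    calc _ = ∑ c, ∑ d, l ((∑ b, antipodeInv k A (cm k A b j) * cm k A d b) *
          (antipodeInv k A t * (∑ a, antipodeInv k A (cm k A a c) * cm k A i a))) •
            HopfAlgebra.antipode k (cm k A c d) := by
          simp only [Finset.mul_sum, Finset.sum_mul, map_sum, Finset.sum_smul, mul_assoc]
          conv_rhs =>
            enter [2, c]
            rw [Finset.sum_comm]
          conv_rhs => rw [Finset.sum_comm]
          refine Finset.sum_congr rfl fun a _ => ?_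
          rw [Finset.sum_comm]
          refine Finset.sum_congr rfl fun c _ => ?_
          rw [Finset.sum_comm]
      _ = _ := by
          simp only [sum_antipodeInv_mul_cm]
          simp [apply_ite l]

/-- At `x` the conjugation degenerates: multiplication on the left gives a counit and on the right a
value of `α`. -/
lemma hom_antipode_cointegral {x : A} (hx : IsLeftCointegral k x) {α : Dual k A}
    (hα : IsModulus x α) (P : Double k A) : dualTensorHom k A A (antipode k A P) x =
      lhit α (HopfAlgebra.antipode k (dualTensorHom k A A P (antipodeInv k A x))) := by
  induction P using TensorProduct.induction_on with
  | zero => simp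
  | add P Q hP hQ => simp only [map_add, LinearMap.add_apply, hP, hQ]
  | tmul l y =>
    induction y using cm_induction (k := k) (A := A) with
    | add a b ha hb => simp only [TensorProduct.tmul_add, map_add, LinearMap.add_apply, ha, hb]
    | smul c a ha => simp only [TensorProduct.tmul_smul, map_smul, LinearMap.smul_apply, ha]
    | zero => simp
    | mem i j =>
      rw [hom_antipode_tmul_cm]
      simp only [hα _, mul_smul_comm, hx _, hom_tmul, map_smul, counit_cm, lhit,
        LinearMap.comp_apply, comul_antipode_cm, map_sum, LinearMap.rTensor_tmul,
        LinearEquiv.coe_coe, TensorProduct.lid_tmul, smul_eq_mul, ite_smul]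
      rw [Finset.sum_comm]
      simp [Finset.smul_sum, smul_smul, mul_comm, apply_ite (antipodeInv k A), apply_ite l]

/-- Right invariance of `μ_D` combines `s x = ε(s) x` on the dual factor with the right invariance
of `μ ∘ S` on `A`. -/
lemma lid_integral_comul {μ : Dual k A} {x : A} (hμ : IsLeftIntegral μ)
    (hx : IsLeftCointegral k x) (P : Double k A) :
    TensorProduct.lid k _ ((integral μ x).rTensor _ (comul k A P)) = integral μ x P • one k A := by
  induction P using TensorProduct.induction_on with
  | zero => simp
  | add P Q hP hQ => simp only [map_add, hP, hQ, add_smul]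
  | tmul l y =>
    induction y using cm_induction (k := k) (A := A) with
    | add a b ha hb => simp only [TensorProduct.tmul_add, map_add, ha, hb, add_smul]
    | smul c a ha => simp only [TensorProduct.tmul_smul, map_smul, ha, smul_assoc]
    | zero => simp
    | mem i j =>
      obtain ⟨S, hS', h⟩ := exists_dualComul l
      refine hom_ext fun s => ?_
      have h1 := hμ.lhit_antipode hS.out (cm k A i j)
      rw [lhit_cm] at h1
      rw [comul_tmul hS']
      simp only [map_sum, LinearMap.rTensor_tmul, TensorProduct.lid_tmul, map_smul,
        LinearMap.sum_apply, LinearMap.smul_apply, hom_tmul, integral_apply, one, dualOne]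
      calc _ = l (s * x) • ∑ m, (μ ∘ₗ HopfAlgebra.antipode k) (cm k A i m) • cm k A m j := by
            simp only [Finset.smul_sum, smul_smul, LinearMap.comp_apply, smul_eq_mul]
            refine Finset.sum_congr rfl fun m _ => ?_
            rw [← Finset.sum_smul, h, Finset.sum_mul]
            congr 1
            exact Finset.sum_congr rfl fun e _ => by ring
        _ = _ := by
            rw [h1, hx s]
            simp only [map_smul, smul_smul, smul_eq_mul]
            congr 1; ring

end

end Double

end QDouble

namespace QDouble

open Module (Dual)
open Coalgebra (counit)

namespace Double

/-! ### The operator 𝒮 on `v` and `v⁻¹` -/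

section

variable {k : Type*} [Field k] {A : Type*} [Ring A] [HopfAlgebra k A] [FiniteDimensional k A]
  [hS : Fact (Function.Bijective (HopfAlgebra.antipode k : A →ₗ[k] A))] {v w : Double k A}
  {β : A →ₐ[k] k} {g : A} {μ : Dual k A} {x : A}

lemma M_eq : M k A = ∑ j, ∑ i, ((Module.Basis.ofVectorSpace k A).coord j ⊗ₜ[k]
      Module.Basis.ofVectorSpace k A i) ⊗ₜ[k]
    mul (ofAlg k A (Module.Basis.ofVectorSpace k A j))
      (ofDual k A ((Module.Basis.ofVectorSpace k A).coord i)) := by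
  rw [M, R_eq, map_sum, sum_mul₂]
  simp only [mul₂_sum, TensorProduct.comm_tmul, mul₂_tmul, ofDual_mul_ofAlg]

lemma modularS_v (hv : IsRibbonElement v w) (hg : Coalgebra.comul (R := k) g = g ⊗ₜ g)
    (hε : counit (R := k) g = 1) (hb : mul w (u k A) = β.toLinearMap ⊗ₜ g)
    (hμ : IsLeftIntegral μ) (hx : IsLeftCointegral k x) (hμx : μ x = 1) :
    modularS μ x v = β g • w := by
  have hη : ∀ (y : A), ∑ j, integral μ x (mul v ((Module.Basis.ofVectorSpace k A).coord j ⊗ₜ y)) •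
      Module.Basis.ofVectorSpace k A j = rhit (charInv β).toLinearMap
        (HopfAlgebra.antipode k g * HopfAlgebra.antipode k (HopfAlgebra.antipode k y)) := by
    intro y
    have h1 : ∀ l : Dual k A, integral μ x (mul v (l ⊗ₜ y)) = l (rhit (charInv β).toLinearMap
        (HopfAlgebra.antipode k g * HopfAlgebra.antipode k (HopfAlgebra.antipode k y))) := by
      intro l
      -- Centrality lets `v` pass `l`, so `μ_D(v · l · y)` is `μ(S(y) g -)` applied to the
      -- cointegral hit by `l` and by `β⁻¹`. The multiplier `p = S(y) g` is thus the one to insert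
      -- into `x₁ μ(p x₂) = S(p)`.
      have h2 := hμ.rhit_mulLeft_cointegral hx (HopfAlgebra.antipode k y * g)
      rw [hμx, one_smul, HopfAlgebra.antipode_mul_antidistrib] at h2
      rw [← h2, rhit_rhit, apply_rhit, ← ofDual_mul_ofAlg, ← mul_assoc', hv.central, mul_assoc',
        integral_apply, hom_ofDual_mul, hom_mul_ofAlg, hom_v hv hg hε hb]
      simp [HopfAlgebra.antipode_mul_antidistrib, antipode_antipode_groupLike hg hε, mul_assoc]
    simp only [h1]
    exact sum_ofVectorSpace _
  have hf : fbar (integral μ x ∘ₗ mulMap k A ∘ₗ TensorProduct.mk k _ _ v) =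
      ∑ i, mul (ofAlg k A (rhit (charInv β).toLinearMap (HopfAlgebra.antipode k g *
        HopfAlgebra.antipode k (HopfAlgebra.antipode k (Module.Basis.ofVectorSpace k A i)))))
          (ofDual k A ((Module.Basis.ofVectorSpace k A).coord i)) := by
    rw [fbar, M_eq, Finset.sum_comm]
    simp only [map_sum, LinearMap.rTensor_tmul, TensorProduct.lid_tmul]
    refine Finset.sum_congr rfl fun i _ => ?_
    rw [← hη, map_sum, sum_mul']
    simp only [map_smul, smul_mul']
    rfl
  refine hom_ext fun t => ?_
  rw [modularS, hf, map_sum, map_sum, LinearMap.sum_apply]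
  simp only [antipode_ofAlg_mul_ofDual, hom_tmul, LinearMap.comp_apply]
  -- The sum over `i` is the expansion of `S⁻¹(t)` in the basis, pushed through a linear map.
  have h3 := congrArg (fun z => HopfAlgebra.antipode k (rhit (charInv β).toLinearMap
    (HopfAlgebra.antipode k g * HopfAlgebra.antipode k (HopfAlgebra.antipode k z))))
    (sum_ofVectorSpace (k := k) (antipodeInv k A t))
  simp only [map_sum, map_smul, Finset.mul_sum, mul_smul_comm, antipode_antipodeInv] at h3
  rw [h3, rhit_mul, rhit_groupLike _ (comul_antipode_groupLike hg), rhit_antipode]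
  have h4 : (charInv β).toLinearMap ∘ₗ HopfAlgebra.antipode k = β.toLinearMap :=
    LinearMap.ext fun z => by
      have := DFunLike.congr_fun (charInv_charInv β) z
      rwa [charInv_apply] at this
  rw [h4, map_smul, LinearMap.smul_apply, hom_w hg hε hb, AlgHom.toLinearMap_apply, charInv_apply,
    antipode_antipode_groupLike hg hε, smul_mul_assoc, map_smul,
    HopfAlgebra.antipode_mul_antidistrib, antipode_antipode_groupLike hg hε]

lemma lid_rTensor_mul₂ (hv : IsRibbonElement v w) (η : Dual k (Double k A))
    (X : Double k A ⊗[k] Double k A) :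
    TensorProduct.lid k _ ((η ∘ₗ mulMap k A ∘ₗ TensorProduct.mk k _ _ w).rTensor _
      (mul₂ (v ⊗ₜ v) X)) = mul v (TensorProduct.lid k _ (η.rTensor _ X)) := by
  induction X using TensorProduct.induction_on with
  | zero => simp [mul₂_zero, mul_zero']
  | add P Q hP hQ => simp only [mul₂_add, map_add, hP, hQ, mul_add']
  | tmul P Q =>
    have h : mul w (mul v P) = P := by rw [← mul_assoc', hv.inv_mul, one_mul']
    simp only [mul₂_tmul, LinearMap.rTensor_tmul, TensorProduct.lid_tmul, mul_smul']
    congr 1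
    exact congrArg η h

lemma modularS_w (hv : IsRibbonElement v w) (hμ : IsLeftIntegral μ)
    (hx : IsLeftCointegral k x) : modularS μ x w = integral μ x w • v := by
  rw [modularS, fbar, hv.monodromy, lid_rTensor_mul₂ hv, lid_integral_comul hμ hx, mul_smul',
    mul_one', map_smul, hv.antipode_eq]

lemma groupLike_mul_rhit (hg : Coalgebra.comul (R := k) g = g ⊗ₜ g)
    (hε : counit (R := k) g = 1) (hx : IsLeftCointegral k x) (γ : A →ₐ[k] k) :
    g * rhit γ.toLinearMap x = (γ g)⁻¹ • rhit γ.toLinearMap x := by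
  have h := congrArg (rhit γ.toLinearMap) (hx g)
  rw [hε, one_smul, rhit_mul, rhit_groupLike _ hg, smul_mul_assoc] at h
  rw [eq_inv_smul_iff₀ (map_groupLike_ne_zero hg hε γ)]
  exact h

lemma groupLike_mul_lhit (hg : Coalgebra.comul (R := k) g = g ⊗ₜ g)
    (hε : counit (R := k) g = 1) (hx : IsLeftCointegral k x) (γ : A →ₐ[k] k) :
    g * lhit γ.toLinearMap x = (γ g)⁻¹ • lhit γ.toLinearMap x := by
  have h := congrArg (lhit γ.toLinearMap) (hx g)
  rw [hε, one_smul, lhit_mul, lhit_groupLike _ hg, smul_mul_assoc] at h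
  rw [eq_inv_smul_iff₀ (map_groupLike_ne_zero hg hε γ)]
  exact h

/-- The formula for `S²` cancels the left hit in `w(x) = S²(β(x₁) x₂) g`, leaving `g x₁ β(x₂) =
β(g)⁻¹ x₁ β(x₂)`. Right invariance of `μ ∘ S` then replaces the factor `β(x₂)` by `β(1)`. -/
lemma integral_w (hv : IsRibbonElement v w) (hg : Coalgebra.comul (R := k) g = g ⊗ₜ g)
    (hε : counit (R := k) g = 1) (hb : mul w (u k A) = β.toLinearMap ⊗ₜ g)
    (hμ : IsLeftIntegral μ) (hx : IsLeftCointegral k x) :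
    integral μ x w = (β g)⁻¹ * μ (HopfAlgebra.antipode k x) := by
  have h1 := apply_rhit β.toLinearMap (μ ∘ₗ HopfAlgebra.antipode k) x
  rw [hμ.lhit_antipode hS.out, map_smul, AlgHom.toLinearMap_apply, map_one] at h1
  rw [integral_apply, hom_w hg hε hb, antipode_antipode_eq hv hg hε hb, ← lhit_rhit_comm,
    lhit_rhit_comm, lhit_rhit_comm, lhit_charInv_lhit, mul_assoc, antipode_mul_groupLike hg hε,
    mul_one, groupLike_mul_rhit hg hε hx, map_smul, map_smul, smul_eq_mul]
  congr 1
  simpa using h1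

/-- Two expressions for the hits of `x` by `β` and `β⁻¹`, one from `S(v) = v` and one from `S²(x) =
c x`, determine `α(g)` and then `c` in terms of `β(g)`. -/
lemma apply_antipode_cointegral (hv : IsRibbonElement v w)
    (hg : Coalgebra.comul (R := k) g = g ⊗ₜ g)
    (hε : counit (R := k) g = 1) (hb : mul w (u k A) = β.toLinearMap ⊗ₜ g)
    (hμ : IsLeftIntegral μ) (hx : IsLeftCointegral k x) (hμx : μ x = 1) :
    μ (HopfAlgebra.antipode k x) = ((β g)⁻¹) ^ 4 := by
  set α := modulus hμ hx hμx
  set c := μ (HopfAlgebra.antipode k x)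
  have hα : ∀ h, x * h = α h • x := mul_eq_modulus_smul hμ hx hμx
  have hβ0 := map_groupLike_ne_zero hg hε β
  have hα0 := map_groupLike_ne_zero hg hε α
  have hgi := comul_antipode_groupLike (k := k) hg
  have hSg := map_antipode_groupLike hg hε
  have hSS := antipode_antipode_groupLike hg hε
  have hxg : x * HopfAlgebra.antipode k g = (α g)⁻¹ • x := by rw [hα, hSg]
  -- the antipode of `v`, evaluated at the cointegral
  have hA : rhit (charInv α).toLinearMap (rhit β.toLinearMap x) =
      α g • lhit (charInv β).toLinearMap x := by
    have h1 := hom_antipode_cointegral hx (α := α.toLinearMap) hα v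
    have h2 : (charInv β).toLinearMap ∘ₗ antipodeInv k A = β.toLinearMap :=
      LinearMap.ext fun z => by
        simp [apply_antipodeInv]
    have h3 : α.toLinearMap ∘ₗ antipodeInv k A = (charInv α).toLinearMap :=
      LinearMap.ext fun z => by
        simp [apply_antipodeInv]
    rw [hv.antipode_eq, hom_v hv hg hε hb, hom_v hv hg hε hb, lhit_antipodeInv, h2,
      HopfAlgebra.antipode_mul_antidistrib, hSS, antipode_antipodeInv, lhit_mul,
      lhit_groupLike _ hg, lhit_antipodeInv, h3] at h1
    have h4 := congrArg (HopfAlgebra.antipode k) h1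
    simp only [HopfAlgebra.antipode_mul_antidistrib, hSS, antipode_antipodeInv, smul_mul_assoc,
      map_smul, AlgHom.toLinearMap_apply] at h4
    have h5 := congrArg (fun z => rhit (charInv α).toLinearMap (rhit β.toLinearMap z)) hxg
    simp only [rhit_mul, rhit_groupLike _ hgi, map_smul, AlgHom.toLinearMap_apply, charInv_apply,
      hSg, inv_inv, mul_smul_comm, smul_smul] at h5
    rw [groupLike_mul_lhit hg hε hx, charInv_apply, hSg, inv_inv] at h4
    have h6 : rhit (charInv α).toLinearMap (rhit β.toLinearMap x) * HopfAlgebra.antipode k g =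
        ((β g)⁻¹ * α g)⁻¹ • (α g)⁻¹ • rhit (charInv α).toLinearMap (rhit β.toLinearMap x) := by
      rw [← h5, smul_smul, inv_mul_cancel₀ (mul_ne_zero (inv_ne_zero hβ0) hα0), one_smul]
    rw [h6] at h4
    have h7 := congrArg (fun z => (α g * (β g)⁻¹) • z) h4
    simp only [smul_smul] at h7
    rw [show α g * (β g)⁻¹ * β g = α g by field_simp,
      show α g * (β g)⁻¹ * (α g * (((β g)⁻¹ * α g)⁻¹ * (α g)⁻¹)) = 1 by field_simp,
      one_smul] at h7
    exact h7.symm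
  -- Compare `S²(x) = c x` with `antipode_antipode_eq`: the left factor `g` acts trivially because
  -- the two hits contribute inverse scalars, while the right factor contributes `α(g)⁻¹`.
  have hB : lhit (charInv β).toLinearMap x = (c * α g) • rhit (charInv β).toLinearMap x := by
    have h1 := antipode_antipode_cointegral hμ hx hμx
    rw [antipode_antipode_eq hv hg hε hb] at h1
    have h2 := congrArg (fun z => lhit (charInv β).toLinearMap (rhit β.toLinearMap z)) hxg
    simp only [rhit_mul, lhit_mul, rhit_groupLike _ hgi, lhit_groupLike _ hgi, map_smul,
      AlgHom.toLinearMap_apply, charInv_apply, hSg, inv_inv, mul_smul_comm, smul_smul,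
      inv_mul_cancel₀ hβ0, one_smul] at h2
    have h3 := congrArg (fun z => lhit (charInv β).toLinearMap (rhit β.toLinearMap z)) (hx g)
    simp only [hε, rhit_mul, lhit_mul, rhit_groupLike _ hg, lhit_groupLike _ hg, map_smul,
      AlgHom.toLinearMap_apply, charInv_apply, hSg, smul_mul_assoc, smul_smul,
      mul_inv_cancel₀ hβ0, one_smul] at h3
    rw [h3, h2] at h1
    have h4 := congrArg (fun z => α g • rhit (charInv β).toLinearMap z) h1
    simp only [map_smul, smul_smul, mul_inv_cancel₀ hα0, one_smul, ← lhit_rhit_comm,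
      rhit_charInv_rhit] at h4
    rw [h4, mul_comm]
  -- Substituting `hB` into `hA` leaves only right hits of `x` on both sides, so the functionals
  -- themselves agree. At `1` and `g` they give `1 = α(g)² c` and `α(g) = β(g)²`.
  have hC : rhit (β.toLinearMap ∘ₗ lhit (charInv α).toLinearMap) x =
      rhit ((α g * (c * α g)) • (charInv β).toLinearMap) x := by
    rw [← rhit_rhit, hA, hB, rhit_smul, LinearMap.smul_apply, smul_smul]
  have hD := rhit_injective hS.out hμ hx hμx hC
  have h1 := LinearMap.congr_fun hD 1
  have h2 := LinearMap.congr_fun hD g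
  have hone : lhit (charInv α).toLinearMap (1 : A) = 1 := by
    rw [lhit_groupLike _ (by simp [Algebra.TensorProduct.one_def])]
    simp
  simp only [LinearMap.comp_apply, hone, lhit_groupLike _ hg, map_smul, LinearMap.smul_apply,
    AlgHom.toLinearMap_apply, map_one, charInv_apply, hSg, smul_eq_mul, mul_one] at h1 h2
  rw [← h1, one_mul] at h2
  have h3 : α g = β g ^ 2 := by
    field_simp at h2
    rw [h2]
  rw [h3] at h1
  field_simp
  rw [h1]; ring

end

end Double

end QDouble

end

theorem mainTheorem11 {k : Type*} [Field k] {A : Type*} [Ring A] [HopfAlgebra k A]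
    [FiniteDimensional k A]
    -- the antipode of `A` is invertible
    (hS : Function.Bijective (HopfAlgebra.antipode k : A →ₗ[k] A))
    -- a left integral and a left cointegral of `A`, normalised against each other
    (μ : Module.Dual k A) (x : A)
    (hμ : QDouble.IsLeftIntegral μ) (hx : QDouble.IsLeftCointegral k x) (hμx : μ x = 1)
    -- a ribbon element `v` of `D(A)`, with inverse `w = v⁻¹`
    (v w : QDouble.Double k A) (hv : QDouble.Double.IsRibbonElement v w)
    -- the number `ν` associated to the balancing `b = v⁻¹ u`: `ν⁻¹ = χ(b)`
    (ν : k) (hν : ν = (QDouble.Double.chi k A (QDouble.Double.mul w (QDouble.Double.u k A)))⁻¹) :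
    ν ≠ 0 ∧
      -- `ν` is a fourth root of `ω = α(a)`
      (∀ (α : Module.Dual k A) (a : A),
        QDouble.IsModulus x α → QDouble.IsComodulus μ a → ν ^ 4 = α a) ∧
      QDouble.Double.modularS μ x v = ν⁻¹ • w ∧
      QDouble.Double.modularS μ x w = ν ^ 5 • v := by
  have := Fact.mk hS
  obtain ⟨β, g, hg, hε, hb⟩ := hv.exists_groupLike
  have hν' : ν = (β g)⁻¹ := by
    rw [hν, hb, QDouble.Double.chi, contractLeft_apply]
    rfl
  have hβ := QDouble.map_groupLike_ne_zero hg hε β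
  have hc := QDouble.Double.apply_antipode_cointegral hv hg hε hb hμ hx hμx
  rw [← hν'] at hc
  refine ⟨by rw [hν']; exact inv_ne_zero hβ, fun α a hα ha => ?_, ?_, ?_⟩
  -- Since `μ(x) = 1`, one has `a = μ(x₁) x₂`, `α = μ(x -)` and `S(x) = x₁ α(x₂)`. Hence `α(a) =
  -- μ(x₁) α(x₂) = μ(S x)`, which is `ν⁴`.
  · have h1 : QDouble.lhit μ x = a := by
      have := ha x
      rwa [hμx, one_smul] at this
    have h2 := hμ.rhit_mulLeft_cointegral hx x
    have h3 : μ ∘ₗ LinearMap.mulLeft k x = α := LinearMap.ext fun h => by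
      simp [hα h, hμx]
    rw [hμx, one_smul, h3] at h2
    rw [← hc, ← h2, QDouble.apply_rhit, h1]
  · rw [QDouble.Double.modularS_v hv hg hε hb hμ hx hμx, hν', inv_inv]
  -- The fifth power is the factor `β(g)⁻¹ = ν` of `μ_D(w)` times `μ(S x) = ν⁴`.
  · rw [QDouble.Double.modularS_w hv hμ hx, QDouble.Double.integral_w hv hg hε hb hμ hx, hc, hν']
    congr 1
    ring
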